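/- Let $p$ be a prime number. Semirings are commutative with $0$ and $1$. Let $\Lambda_{\mathbb N}=\bigoplus_\lambda \mathbb N m_\lambda$ be the semiring of symmetric functions in $x_1,x_2,\dots$ with coefficients in $\mathbb N$, let $\circ$ denote plethysm, and put $\psi=\sum_i x_i^p$, $d=\frac1p\big((\sum_i x_i)^p-\sum_i x_i^p\big)$ and $d_{i,j}=d^{\circ i}\circ\psi^{\circ j}$ for $i,j\in\mathbb N$. Let $\Lambda_{\mathbb N,(p)}\subseteq\Lambda_{\mathbb N}$ be the subsemiring generated by all $d_{i,j}$. For a semiring $A$ let $W_{(p)}(A)$ be the set of semiring homomorphisms $a:\Lambda_{\mathbb N,(p)}\to A$, with the semiring structure induced by the co-operations $\Delta^+,\Delta^\times:\Lambda_{\mathbb N,(p)}\to\Lambda_{\mathbb N,(p)}\otimes_{\mathbb N}\Lambda_{\mathbb N,(p)}$, $\Delta^+ f=f(\dots,x_i\otimes1,1\otimes x_i,\dots)$, $\Delta^\times f=f(\dots,x_i\otimes x_j,\dots)$, and the co-units $\varepsilon^+f=f(0,0,\dots)$, $\varepsilon^\times f=f(1,0,0,\dots)$. Write $a_{i,j}=a(d_{i,j})$.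 Let $\mathbb B=\{0,1\}$ be the Boolean semiring, in which $1+1=1$. Order $W_{(p)}(\mathbb B)$ by $a\preccurlyeq b$ if and only if for every $f\in\Lambda_{\mathbb N,(p)}$ there is $c\in\mathbb B$ with $b(f)=a(f)+c$. (1) There is an isomorphism of partially ordered sets $\mathbb N^2\cup\{\infty\}\to W_{(p)}(\mathbb B)$, where $\mathbb N^2$ has the componentwise order and $\infty$ is the greatest element. It sends $(x,y)$ to the Witt vector with $a_{i,j}=0\Leftrightarrow (i\ge x \text{ and } j\ge y)$, and $\infty$ to the Witt vector with $a_{i,j}=1$ for all $i,j$. (2) The semiring structure on $\mathbb N^2\cup\{\infty\}$ inherited through this bijection satisfies, for all $x,x',y,y'\in\mathbb N$: (a) the image of $n\in\mathbb N$ is $(n,0)$ if $n\le1$ (if $n\le 2$ when $p=2$), and is $\infty$ otherwise; (b) $(x,0)+(x',0)=\infty$ if $x,x'\ge2$; (c) $(0,y)+(0,y')=(0,\max\{y,y'\})$; (d) $(x,0)+(0,y)=(x,y)$; (e) $\infty+z=\infty$ for all $z\in\mathbb N^2\cup\{\infty\}$; (f) $(x,0)(x',0)=\infty$ if $x,x'\ge2$;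 (g) $(0,y)(0,y')=(0,\min\{y,y'\})$; (h) $(x,0)(0,y)=(0,y)$ if $x\ge1$; (i) $\infty\,(0,y)=(0,y)$; (j) $\infty\,(x,0)=\infty$ if $x\ge1$. (3) With respect to this identification the semiring structure is independent of $p$ for $p>2$: for primes $p,q>2$, the bijection $W_{(p)}(\mathbb B)\to W_{(q)}(\mathbb B)$ that preserves the coordinates in $\mathbb N^2\cup\{\infty\}$ is an isomorphism of semirings. -/

import Mathlib

namespace BooleanWitt

noncomputable section

open MvPolynomial
open scoped TensorProduct

/-! ## The semiring of symmetric functions with natural coefficients -/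

/-- Evaluation of polynomials with natural coefficients at a point of a commutative semiring. -/
abbrev natEval {σ R : Type*} [CommSemiring R] (y : σ → R) : MvPolynomial σ ℕ →+* R :=
  eval₂Hom (Nat.castRingHom R) y

theorem natHom_ext {σ R : Type*} [CommSemiring R] {f g : MvPolynomial σ ℕ →+* R}
    (h : ∀ i, f (X i) = g (X i)) : f = g :=
  ringHom_ext' (Subsingleton.elim _ _) h

/-- The semiring `Λ_ℕ = ⨁ ℕ m_λ` of symmetric functions with coefficients in `ℕ`: a symmetric
function is a compatible sequence of symmetric polynomials `f n ∈ ℕ[x_1, …, x_n]` of bounded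
degree, the transition maps being `f(x_1, …, x_n, x_{n+1}) ↦ f(x_1, …, x_n, 0)`. -/
def SymFun : Subsemiring (∀ n : ℕ, MvPolynomial (Fin n) ℕ) where
  carrier := {f | (∀ n, (f n).IsSymmetric) ∧
    (∀ n, natEval (Fin.snoc X 0 : Fin (n + 1) → MvPolynomial (Fin n) ℕ) (f (n + 1)) = f n) ∧
    ∃ D : ℕ, ∀ n, (f n).totalDegree ≤ D}
  zero_mem' := ⟨fun _ => IsSymmetric.zero, fun _ => map_zero _, 0, fun _ => by simp⟩
  one_mem' := ⟨fun _ => IsSymmetric.one, fun _ => map_one _, 0, fun _ => by simp⟩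
  add_mem' := by
    rintro f g ⟨hf, hf', D, hD⟩ ⟨hg, hg', E, hE⟩
    refine ⟨fun n => (hf n).add (hg n), fun n => ?_, max D E, fun n => ?_⟩
    · simp only [Pi.add_apply, map_add, hf' n, hg' n]
    · exact (totalDegree_add _ _).trans (max_le_max (hD n) (hE n))
  mul_mem' := by
    rintro f g ⟨hf, hf', D, hD⟩ ⟨hg, hg', E, hE⟩
    refine ⟨fun n => (hf n).mul (hg n), fun n => ?_, D + E, fun n => ?_⟩
    · simp only [Pi.mul_apply, map_mul, hf' n, hg' n]
    · exact (totalDegree_mul _ _).trans (add_le_add (hD n) (hE n))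

/-- The value `f(s)` of a symmetric function at a finite multiset `s` of elements of a commutative
semiring: `f(r_1, …, r_n, 0, 0, …)` where `s = {r_1, …, r_n}`. -/
def evalAt {R : Type*} [CommSemiring R] (s : Multiset R) : SymFun →+* R :=
  (natEval fun i : Fin s.toList.length => s.toList.get i).comp
    ((Pi.evalRingHom _ s.toList.length).comp SymFun.subtype)

theorem exists_perm_of_map_univ_eq {α : Type*} {n : ℕ} (y z : Fin n → α)
    (h : (Finset.univ.val.map y) = (Finset.univ.val.map z)) :
    ∃ σ : Equiv.Perm (Fin n), z ∘ σ = y := by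
  classical
  have key : ∀ a, Nonempty ({i // y i = a} ≃ {i // z i = a}) := by
    intro a
    rw [← Fintype.card_eq, Fintype.card_subtype, Fintype.card_subtype]
    have := congrArg (Multiset.count a) h
    rw [Multiset.count_map, Multiset.count_map] at this
    simpa [Finset.card, eq_comm] using this
  exact ⟨Equiv.ofFiberEquiv (fun a => (key a).some), by
    funext i; exact Equiv.ofFiberEquiv_map _ _⟩

theorem evalAt_map_univ {R : Type*} [CommSemiring R] {n : ℕ} (y : Fin n → R) (f : SymFun) :
    evalAt (Finset.univ.val.map y) f = natEval y (f.1 n) := by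
  set s : Multiset R := Finset.univ.val.map y with hs
  have hlen : s.toList.length = n := by simp [hs]
  have hz : Finset.univ.val.map (fun i : Fin s.toList.length => s.toList.get i) = s := by
    rw [Fin.univ_val_map, List.ofFn_get, Multiset.coe_toList]
  have aux : ∀ (m : ℕ) (z : Fin m → R), m = n → Finset.univ.val.map z = s →
      natEval z (f.1 m) = natEval y (f.1 n) := by
    rintro m z rfl h
    obtain ⟨σ, rfl⟩ := exists_perm_of_map_univ_eq z y h
    rw [← f.2.1 m σ]
    exact (DFunLike.congr_fun (natHom_ext (f := natEval (y ∘ σ))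
      (g := (natEval y).comp (rename σ : MvPolynomial (Fin m) ℕ →ₐ[ℕ] _).toRingHom)
      fun i => by simp) _).trans (by rw [f.2.1 m σ]; simp [f.2.1 m σ])
  exact aux _ _ hlen hz

theorem exists_eq_map_univ {R : Type*} (s : Multiset R) :
    ∃ (n : ℕ) (y : Fin n → R), s = Finset.univ.val.map y :=
  ⟨s.toList.length, fun i => s.toList.get i, by rw [Fin.univ_val_map, List.ofFn_get, Multiset.coe_toList]⟩

theorem map_evalAt {R S : Type*} [CommSemiring R] [CommSemiring S] (h : R →+* S)
    (s : Multiset R) (f : SymFun) : h (evalAt s f) = evalAt (s.map h) f := by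
  obtain ⟨n, y, rfl⟩ := exists_eq_map_univ s
  rw [Multiset.map_map, evalAt_map_univ, evalAt_map_univ]
  have : h.comp (natEval y) = natEval (h ∘ y) := natHom_ext fun i => by simp
  exact DFunLike.congr_fun this (f.1 n)

theorem evalAt_zero_cons {R : Type*} [CommSemiring R] (s : Multiset R) (f : SymFun) :
    evalAt (0 ::ₘ s) f = evalAt s f := by
  obtain ⟨n, y, rfl⟩ := exists_eq_map_univ s
  have : (0 ::ₘ Finset.univ.val.map y) =
      Finset.univ.val.map (Fin.snoc y 0 : Fin (n + 1) → R) := by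
    rw [Fin.univ_castSuccEmb]
    simp [Function.comp_def]
  rw [this, evalAt_map_univ, evalAt_map_univ, ← f.2.2.1 n]
  have h2 : natEval (Fin.snoc y 0 : Fin (n + 1) → R) =
      (natEval y).comp (natEval (Fin.snoc X 0 : Fin (n + 1) → MvPolynomial (Fin n) ℕ)) := by
    refine natHom_ext fun i => ?_
    refine Fin.lastCases ?_ (fun i => ?_) i <;> simp
  rw [h2]; rfl

theorem evalAt_add_replicate {R : Type*} [CommSemiring R] (s : Multiset R) (k : ℕ) (f : SymFun) :
    evalAt (s + Multiset.replicate k 0) f = evalAt s f := by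
  induction k with
  | zero => simp
  | succ k ih => rw [Multiset.replicate_succ, Multiset.add_cons, evalAt_zero_cons, ih]

/-- The component `f n` is the value of `f` at the variables `x_1, …, x_n`. -/
theorem evalAt_X (n : ℕ) (f : SymFun) :
    evalAt (Finset.univ.val.map (X : Fin n → MvPolynomial (Fin n) ℕ)) f = f.1 n := by
  rw [evalAt_map_univ]
  exact DFunLike.congr_fun (natHom_ext (g := RingHom.id _) fun i => by simp) (f.1 n)

/-- The power sum `∑ x_i ^ k`, for `k ≥ 1`. -/
def powerSum (k : ℕ) (hk : k ≠ 0) : SymFun :=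
  ⟨fun n => psum (Fin n) ℕ k, fun _ => psum_isSymmetric _ _ _, fun n => by
    simp [psum, Fin.sum_univ_castSucc, hk], k, fun n => by
    refine (totalDegree_finsetSum _ _).trans (Finset.sup_le fun i _ => ?_)
    exact (totalDegree_pow _ _).trans (by simp)⟩

theorem evalAt_powerSum {R : Type*} [CommSemiring R] (s : Multiset R) (k : ℕ) (hk : k ≠ 0) :
    evalAt s (powerSum k hk) = (s.map (· ^ k)).sum := by
  obtain ⟨n, y, rfl⟩ := exists_eq_map_univ s
  rw [evalAt_map_univ, Multiset.map_map]
  change natEval y (∑ i, X i ^ k) = ∑ i, y i ^ k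
  simp

/-! ## Plethysm -/

/-- The monomials of a polynomial with natural coefficients, listed with multiplicity. -/
def monomials {σ : Type*} (q : MvPolynomial σ ℕ) : Multiset (MvPolynomial σ ℕ) :=
  ∑ α ∈ q.support, q.coeff α • {monomial α 1}

theorem monomials_add {σ : Type*} (q r : MvPolynomial σ ℕ) :
    monomials (q + r) = monomials q + monomials r := by
  classical
  have key : ∀ (t : MvPolynomial σ ℕ) (T : Finset (σ →₀ ℕ)), t.support ⊆ T → monomials t =
      ∑ α ∈ T, t.coeff α • ({monomial α 1} : Multiset (MvPolynomial σ ℕ)) := by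
    intro t T hT
    refine Finset.sum_subset hT fun α _ h => ?_
    rw [notMem_support_iff.1 h, zero_smul]
  rw [key (q + r) (q.support ∪ r.support) support_add,
    key q (q.support ∪ r.support) Finset.subset_union_left,
    key r (q.support ∪ r.support) Finset.subset_union_right, ← Finset.sum_add_distrib]
  simp only [coeff_add, add_smul]

theorem monomials_zero {σ : Type*} : monomials (0 : MvPolynomial σ ℕ) = 0 := by
  simp [monomials]

theorem monomials_monomial {σ : Type*} (α : σ →₀ ℕ) :
    monomials (monomial α 1 : MvPolynomial σ ℕ) = {monomial α 1} := by
  classical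
  simp [monomials, support_monomial]

theorem natPoly_induction {σ : Type*} {P : MvPolynomial σ ℕ → Prop} (h0 : P 0)
     (hadd : ∀ q r, P q → P r → P (q + r)) (hm : ∀ α, P (monomial α 1)) (q : MvPolynomial σ ℕ) : P q := by
  refine induction_on' q (fun α n => ?_) hadd
  induction n with
  | zero => simpa using h0
  | succ n ih => rw [map_add]; exact hadd _ _ ih (hm α)

theorem sum_monomials {σ : Type*} (q : MvPolynomial σ ℕ) : (monomials q).sum = q := by
  induction q using natPoly_induction with
  | h0 => simp [monomials_zero]
  | hadd q r hq hr => rw [monomials_add, Multiset.sum_add, hq, hr]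
  | hm α => simp [monomials_monomial]

theorem sum_monomials_pow {σ : Type*} (k : ℕ) (q : MvPolynomial σ ℕ) :
    ((monomials q).map (· ^ k)).sum = expand k q := by
  induction q using natPoly_induction with
  | h0 => simp [monomials_zero]
  | hadd q r hq hr => rw [monomials_add, Multiset.map_add, Multiset.sum_add, hq, hr, map_add]
  | hm α => simp [monomials_monomial, monomial_pow]

theorem monomials_map_rename {σ : Type*} (e : Equiv.Perm σ) (q : MvPolynomial σ ℕ) :
    (monomials q).map (rename e) = monomials (rename e q) := by
  induction q using natPoly_induction with
  | h0 => simp [monomials_zero]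
  | hadd q r hq hr => rw [monomials_add, Multiset.map_add, hq, hr, map_add, monomials_add]
  | hm α => simp [monomials_monomial, rename_monomial]

theorem monomials_map_snoc {n : ℕ} (q : MvPolynomial (Fin (n + 1)) ℕ) :
    ∃ k, (monomials q).map (natEval (Fin.snoc X 0 : Fin (n + 1) → MvPolynomial (Fin n) ℕ)) =
      monomials (natEval (Fin.snoc X 0 : Fin (n + 1) → MvPolynomial (Fin n) ℕ) q) +
        Multiset.replicate k 0 := by
  induction q using natPoly_induction with
  | h0 => exact ⟨0, by simp [monomials_zero]⟩
  | hadd q r hq hr =>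
    obtain ⟨k, hk⟩ := hq
    obtain ⟨l, hl⟩ := hr
    refine ⟨k + l, ?_⟩
    rw [monomials_add, Multiset.map_add, hk, hl, map_add, monomials_add, Multiset.replicate_add]
    abel
  | hm α =>
    have h1 : natEval (Fin.snoc X 0 : Fin (n + 1) → MvPolynomial (Fin n) ℕ)
        (monomial α 1 : MvPolynomial (Fin (n + 1)) ℕ) = 0 ∨
        ∃ β, natEval (Fin.snoc X 0 : Fin (n + 1) → MvPolynomial (Fin n) ℕ)
        (monomial α 1 : MvPolynomial (Fin (n + 1)) ℕ) = monomial β 1 := by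
      rw [coe_eval₂Hom, eval₂_monomial, Finsupp.prod_fintype _ _ (by simp), Fin.prod_univ_castSucc]
      rcases eq_or_ne (α (Fin.last n)) 0 with h | h
      · right
        refine ⟨∑ i : Fin n, Finsupp.single i (α i.castSucc), ?_⟩
        simp only [Fin.snoc_castSucc, Fin.snoc_last, h, pow_zero, mul_one, map_one, one_mul]
        simp [monomial_sum_one, X_pow_eq_monomial]
      · left; simp [h]
    rcases h1 with h | ⟨β, h⟩
    · exact ⟨1, by rw [monomials_monomial, Multiset.map_singleton, h, monomials_zero]; rfl⟩
    · exact ⟨0, by rw [monomials_monomial, Multiset.map_singleton, h, monomials_monomial]; rfl⟩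

/-- Plethysm `f ∘ g` of symmetric functions: if `g = y_1 + y_2 + ⋯` with monomials `y_i` listed
with multiplicity, then `f ∘ g = f(y_1, y_2, …)`. -/
def plethysm (f g : SymFun) : SymFun :=
  ⟨fun n => evalAt (monomials (g.1 n)) f, by
    refine ⟨fun n e => ?_, fun n => ?_, ?_⟩
    · have := map_evalAt (rename e : MvPolynomial (Fin n) ℕ →ₐ[ℕ] _).toRingHom
        (monomials (g.1 n)) f
      refine this.trans ?_
      change evalAt ((monomials (g.1 n)).map (rename e)) f = _
      rw [monomials_map_rename, g.2.1 n e]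
    · have := map_evalAt (natEval (Fin.snoc X 0 : Fin (n + 1) → MvPolynomial (Fin n) ℕ))
        (monomials (g.1 (n + 1))) f
      refine this.trans ?_
      obtain ⟨k, hk⟩ := monomials_map_snoc (g.1 (n + 1))
      change evalAt ((monomials (g.1 (n + 1))).map (natEval _)) f = _
      rw [hk, evalAt_add_replicate, g.2.2.1 n]
    · obtain ⟨D, hD⟩ := f.2.2.2
      obtain ⟨E, hE⟩ := g.2.2.2
      refine ⟨D * E, fun n => ?_⟩
      have hmon : ∀ y ∈ monomials (g.1 n), y.totalDegree ≤ E := by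
        intro y hy
        rw [monomials, Multiset.mem_sum] at hy
        obtain ⟨α, hα, hy⟩ := hy
        have : y = monomial α 1 := by simpa using Multiset.mem_of_mem_nsmul hy
        subst this
        rw [totalDegree_monomial _ one_ne_zero]
        exact (le_totalDegree hα).trans (hE n)
      obtain ⟨m, y, hy⟩ := exists_eq_map_univ (monomials (g.1 n))
      rw [hy] at hmon
      change (evalAt (monomials (g.1 n)) f).totalDegree ≤ _
      rw [hy, evalAt_map_univ, coe_eval₂Hom, eval₂_eq]
      refine (totalDegree_finsetSum _ _).trans (Finset.sup_le fun α hα => ?_)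
      refine (totalDegree_mul _ _).trans ?_
      have h0 : (Nat.castRingHom (MvPolynomial (Fin n) ℕ) ((f.1 m).coeff α)).totalDegree = 0 := by
        rw [eq_natCast, ← C_eq_coe_nat]; exact totalDegree_C _
      rw [h0, zero_add]
      refine (totalDegree_finsetProd _ _).trans ?_
      calc ∑ i ∈ α.support, (y i ^ α i).totalDegree ≤ ∑ i ∈ α.support, α i * E := by
            refine Finset.sum_le_sum fun i _ => (totalDegree_pow _ _).trans ?_
            exact Nat.mul_le_mul_left _ (hmon _ (Multiset.mem_map_of_mem _ (by simp)))
        _ = (α.sum fun _ k => k) * E := by rw [Finsupp.sum, Finset.sum_mul]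
        _ ≤ D * E := Nat.mul_le_mul_right _ ((le_totalDegree hα).trans (hD m))⟩

theorem plethysm_val (f g : SymFun) (n : ℕ) :
    (plethysm f g).1 n = evalAt (monomials (g.1 n)) f := rfl

theorem plethysm_add (f f' g : SymFun) :
    plethysm (f + f') g = plethysm f g + plethysm f' g :=
  Subtype.ext (funext fun n => map_add (evalAt (monomials (g.1 n))) f f')

theorem plethysm_mul (f f' g : SymFun) :
    plethysm (f * f') g = plethysm f g * plethysm f' g :=
  Subtype.ext (funext fun n => map_mul (evalAt (monomials (g.1 n))) f f')

theorem plethysm_pow (f g : SymFun) (k : ℕ) : plethysm (f ^ k) g = plethysm f g ^ k :=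
  Subtype.ext (funext fun n => map_pow (evalAt (monomials (g.1 n))) f k)

theorem plethysm_natCast (k : ℕ) (g : SymFun) : plethysm (k : SymFun) g = k :=
  Subtype.ext (funext fun n => map_natCast (evalAt (monomials (g.1 n))) k)

theorem plethysm_one_powerSum (g : SymFun) : plethysm (powerSum 1 one_ne_zero) g = g :=
  Subtype.ext (funext fun n => by rw [plethysm_val, evalAt_powerSum]; simp [sum_monomials])

theorem plethysm_powerSum_val (k : ℕ) (hk : k ≠ 0) (g : SymFun) (n : ℕ) :
    (plethysm (powerSum k hk) g).1 n = expand k (g.1 n) := by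
  rw [plethysm_val, evalAt_powerSum, sum_monomials_pow]

theorem evalAt_plethysm_powerSum {R : Type*} [CommSemiring R] (s : Multiset R) (k : ℕ)
    (hk : k ≠ 0) (f : SymFun) :
    evalAt s (plethysm (powerSum k hk) f) = evalAt (s.map (· ^ k)) f := by
  obtain ⟨n, y, rfl⟩ := exists_eq_map_univ s
  rw [Multiset.map_map, evalAt_map_univ, evalAt_map_univ, plethysm_powerSum_val]
  exact DFunLike.congr_fun (natHom_ext (f := (natEval y).comp
    (expand k : MvPolynomial (Fin n) ℕ →ₐ[ℕ] _).toRingHom) fun i => by simp) (f.1 n)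

/-! ## The `p`-typical symmetric functions -/

/-- Cancellation of summands and of factors `p`. -/
def PCancel (p : ℕ) (R : Type*) [CommSemiring R] : Prop :=
  ∀ x y z : R, (p : R) * x + z = (p : R) * y + z → x = y

theorem PCancel.of_injective {p : ℕ} (hp : p ≠ 0) {R ι : Type*} [CommSemiring R]
    (h : R →+ (ι → ℕ)) (hh : Function.Injective h) : PCancel p R := by
  intro x y z e
  apply hh
  have e' := congrArg h e
  simp only [← nsmul_eq_mul, map_add, map_nsmul] at e'
  funext i
  have := congrFun (add_right_cancel e') i
  simpa [hp] using this

theorem PCancel.symFun {p : ℕ} (hp : p ≠ 0) : PCancel p SymFun :=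
  PCancel.of_injective (ι := Σ n : ℕ, (Fin n →₀ ℕ)) hp
    { toFun := fun f i => (f.1 i.1).coeff i.2
      map_zero' := by funext i; simp
      map_add' := fun f g => by funext i; simp }
    fun f g h => by
      refine Subtype.ext (funext fun n => MvPolynomial.ext _ _ fun α => ?_)
      exact congrFun h ⟨n, α⟩

theorem PCancel.mvPolynomial {p : ℕ} (hp : p ≠ 0) (σ : Type*) :
    PCancel p (MvPolynomial σ ℕ) :=
  PCancel.of_injective (ι := σ →₀ ℕ) hp
    { toFun := fun f i => f.coeff i
      map_zero' := by funext i; simp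
      map_add' := fun f g => by funext i; simp }
    fun f g h => MvPolynomial.ext _ _ fun α => congrFun h α

/-- The elements `a` for which `a ^ p` is `φ a` plus a multiple of `p`. -/
def frobSubsemiring (p : ℕ) [hp : Fact p.Prime] {R : Type*} [CommSemiring R] (φ : R →+* R) :
    Subsemiring R where
  carrier := {a | ∃ b, a ^ p = p * b + φ a}
  zero_mem' := ⟨0, by simp [hp.out.ne_zero]⟩
  one_mem' := ⟨0, by simp⟩
  add_mem' := by
    rintro a a' ⟨b, hb⟩ ⟨b', hb'⟩
    obtain ⟨r, hr⟩ := exists_add_pow_prime_eq hp.out a a'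
    exact ⟨b + b' + a * a' * r, by rw [hr, hb, hb', map_add]; ring⟩
  mul_mem' := by
    rintro a a' ⟨b, hb⟩ ⟨b', hb'⟩
    exact ⟨p * b * b' + b * φ a' + φ a * b', by rw [mul_pow, hb, hb', map_mul]; ring⟩

variable (p : ℕ) [hp : Fact p.Prime]

/-- `ψ = ∑ x_i ^ p`. -/
def psi : SymFun := powerSum p hp.out.ne_zero

/-- `e = ∑ x_i`, the identity for plethysm. -/
def idSym : SymFun := powerSum 1 one_ne_zero

theorem exists_unique_dSym : ∃! d : SymFun, p * d + psi p = idSym ^ p := by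
  have hX : ∀ (n : ℕ) (i : Fin n), (X i : MvPolynomial (Fin n) ℕ) ∈
      frobSubsemiring p (expand p : MvPolynomial (Fin n) ℕ →ₐ[ℕ] _).toRingHom := fun n i =>
    ⟨0, by simp⟩
  have h1 : ∀ n : ℕ, ∃ b : MvPolynomial (Fin n) ℕ,
      (p : MvPolynomial (Fin n) ℕ) * b + psum _ _ p = psum _ _ 1 ^ p := by
    intro n
    obtain ⟨b, hb⟩ := sum_mem fun (i : Fin n) (_ : i ∈ Finset.univ) => hX n i
    refine ⟨b, ?_⟩
    rw [psum_one, hb]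
    simp [psum]
  choose b hb using h1
  have hc := fun n => PCancel.mvPolynomial hp.out.ne_zero (Fin n)
  have hmem : b ∈ SymFun := by
    refine ⟨fun n σ => ?_, fun n => ?_, p, fun n => ?_⟩
    · apply hc n _ _ (psum _ _ p)
      rw [hb n]
      have := congrArg (rename σ) (hb n)
      rwa [map_add, map_mul, map_pow, map_natCast, rename_psum, rename_psum] at this
    · apply hc n _ _ (psum _ _ p)
      rw [hb n]
      have := congrArg (natEval (Fin.snoc X 0 : Fin (n + 1) → MvPolynomial (Fin n) ℕ)) (hb (n + 1))
      rw [map_add, map_mul, map_pow, map_natCast] at this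
      have e := fun k hk => (powerSum k hk).2.2.1 n
      simp only [powerSum] at e
      rwa [e p hp.out.ne_zero, e 1 one_ne_zero] at this
    · have h2 : (b n).support ⊆ ((p : MvPolynomial (Fin n) ℕ) * b n + psum _ _ p).support := by
        intro α hα
        rw [mem_support_iff] at hα ⊢
        rw [← nsmul_eq_mul, coeff_add, coeff_smul]
        have := hp.out.pos
        simp only [smul_eq_mul]
        positivity
      rw [hb n] at h2
      refine (totalDegree_le_of_support_subset h2).trans ((totalDegree_pow _ _).trans ?_)
      have : (psum (Fin n) ℕ 1).totalDegree ≤ 1 :=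
        (totalDegree_finsetSum _ _).trans (Finset.sup_le fun i _ => by simp)
      exact (Nat.mul_le_mul_left p this).trans (by simp)
  refine ⟨⟨b, hmem⟩, Subtype.ext (funext fun n => hb n), fun d hd => ?_⟩
  apply PCancel.symFun hp.out.ne_zero _ _ (psi p)
  rw [hd]
  exact (Subtype.ext (funext fun n => hb n)).symm

/-- `d = ((∑ x_i) ^ p - ∑ x_i ^ p) / p`. -/
def dSym : SymFun := (exists_unique_dSym p).choose

theorem dSym_spec : p * dSym p + psi p = idSym ^ p := (exists_unique_dSym p).choose_spec.1

/-- `d_{i,j} = d ∘ ⋯ ∘ d ∘ ψ ∘ ⋯ ∘ ψ`, with `i` factors `d` and `j` factors `ψ`. -/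
def dd (i j : ℕ) : SymFun := (plethysm (dSym p))^[i] ((plethysm (psi p))^[j] idSym)

/-- The semiring `Λ_{ℕ,(p)}` of `p`-typical symmetric functions: the subsemiring of `Λ_ℕ` generated
by the elements `d_{i,j}`. -/
def PTypSymFun : Subsemiring SymFun :=
  Subsemiring.closure (Set.range fun ij : ℕ × ℕ => dd p ij.1 ij.2)

theorem plethysm_dSym (g : SymFun) : p * plethysm (dSym p) g + plethysm (psi p) g = g ^ p := by
  have := congrArg (fun f => plethysm f g) (dSym_spec p)
  simpa only [plethysm_add, plethysm_mul, plethysm_pow, plethysm_natCast, idSym,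
    plethysm_one_powerSum] using this

/-- `g ↦ ψ ∘ g` is an endomorphism of the semiring of symmetric functions. -/
def adams : SymFun →+* SymFun where
  toFun g := plethysm (psi p) g
  map_one' := Subtype.ext (funext fun n => by
    rw [psi, plethysm_powerSum_val]; exact map_one (expand p))
  map_zero' := Subtype.ext (funext fun n => by
    rw [psi, plethysm_powerSum_val]; exact map_zero (expand p))
  map_add' f g := Subtype.ext (funext fun n => by
    rw [psi, plethysm_powerSum_val]; simp [plethysm_powerSum_val])
  map_mul' f g := Subtype.ext (funext fun n => by
    rw [psi, plethysm_powerSum_val]; simp [plethysm_powerSum_val])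

theorem psi_d_comm (g : SymFun) :
    plethysm (psi p) (plethysm (dSym p) g) = plethysm (dSym p) (plethysm (psi p) g) := by
  apply PCancel.symFun hp.out.ne_zero _ _ (plethysm (psi p) (plethysm (psi p) g))
  rw [plethysm_dSym]
  have := congrArg (adams p) (plethysm_dSym p g)
  rw [map_add, map_mul, map_natCast, map_pow] at this
  exact this

theorem psi_dd (i j : ℕ) : plethysm (psi p) (dd p i j) = dd p i (j + 1) := by
  rw [dd, dd, Function.iterate_succ_apply' (plethysm (psi p)) j]
  generalize (plethysm (psi p))^[j] idSym = g
  induction i generalizing g with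
  | zero => rfl
  | succ i ih => rw [Function.iterate_succ_apply, Function.iterate_succ_apply, ih, psi_d_comm]

theorem dd_rel (i j : ℕ) : p * dd p (i + 1) j + dd p i (j + 1) = dd p i j ^ p := by
  rw [← psi_dd, ← plethysm_dSym p (dd p i j)]
  rw [dd, Function.iterate_succ_apply' _ i]; rfl

theorem evalAt_adams {R : Type*} [CommSemiring R] (s : Multiset R) (f : SymFun) :
    evalAt s (plethysm (psi p) f) = evalAt (s.map (· ^ p)) f :=
  evalAt_plethysm_powerSum _ _ _ _

theorem evalAt_dd_zero {R : Type*} [CommSemiring R] (s : Multiset R) (j : ℕ) :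
    evalAt s (dd p 0 j) = (s.map (· ^ p ^ j)).sum := by
  induction j generalizing s with
  | zero => simp [dd, idSym, evalAt_powerSum]
  | succ j ih =>
    rw [← psi_dd, evalAt_adams, ih, Multiset.map_map]
    simp [← pow_mul, pow_succ']

/-! ## Linear independence of the reduced monomials in the `d_{i,j}` -/

/-- The polynomial expressing `d_{i,j}` through the power sums `ψ_{p^j}` over `ℚ`. -/
def dPoly : ℕ → ℕ → MvPolynomial ℕᵒᵈ ℚ
  | 0, j => X (OrderDual.toDual j)
  | i + 1, j => C (p : ℚ)⁻¹ * (dPoly i j ^ p - dPoly i (j + 1))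

theorem dPoly_degree (i j : ℕ) : dPoly p i j ≠ 0 ∧
    MonomialOrder.degLex.degree (dPoly p i j) = Finsupp.single (OrderDual.toDual j) (p ^ i) := by
  induction i generalizing j with
  | zero => exact ⟨X_ne_zero _, by simp [dPoly, MonomialOrder.degree_X]⟩
  | succ i ih =>
    have hp0 : (p : ℚ)⁻¹ ≠ 0 := inv_ne_zero (Nat.cast_ne_zero.2 hp.out.ne_zero)
    have hlt : MonomialOrder.degLex.toSyn (MonomialOrder.degLex.degree (dPoly p i (j + 1))) <
        MonomialOrder.degLex.toSyn (MonomialOrder.degLex.degree (dPoly p i j ^ p)) := by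
      rw [MonomialOrder.degree_pow, (ih j).2, (ih (j + 1)).2, MonomialOrder.degLex_lt_iff,
        Finsupp.DegLex.lt_iff]
      left
      simp only [ofDegLex_toDegLex, Finsupp.smul_single, Finsupp.degree_single, smul_eq_mul]
      exact lt_mul_of_one_lt_left (pow_pos hp.out.pos i) hp.out.one_lt
    have hdeg := MonomialOrder.degree_sub_of_lt hlt
    have hne : dPoly p i j ^ p - dPoly p i (j + 1) ≠ 0 := by
      intro h
      rw [sub_eq_zero] at h
      rw [h] at hlt
      exact lt_irrefl _ hlt
    refine ⟨mul_ne_zero (by simpa using hp0) hne, ?_⟩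
    rw [dPoly, MonomialOrder.degree_mul (by simpa using hp0) hne, hdeg, MonomialOrder.degree_pow,
      (ih j).2, MonomialOrder.degree_C]
    simp [pow_succ']

/-- Exponents of the monomials in the `d_{i,j}` in which no factor occurs `p` times. -/
abbrev RedExp : Type := {e : ℕ × ℕ →₀ ℕ // ∀ k, e k < p}

/-- Base `p` digits are unique. -/
theorem digits_unique (N : ℕ) (e e' : ℕ → ℕ) (he : ∀ i, e i < p) (he' : ∀ i, e' i < p)
    (h : ∑ i ∈ Finset.range N, e i * p ^ i = ∑ i ∈ Finset.range N, e' i * p ^ i) :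
    ∀ i < N, e i = e' i := by
  induction N generalizing e e' with
  | zero => intro i hi; omega
  | succ N ih =>
    rw [Finset.sum_range_succ', Finset.sum_range_succ'] at h
    simp only [pow_succ', pow_zero, mul_one, mul_left_comm _ p] at h
    rw [← Finset.mul_sum, ← Finset.mul_sum] at h
    have h0 : e 0 = e' 0 := by
      have := congrArg (· % p) h
      simpa [Nat.mod_eq_of_lt (he 0), Nat.mod_eq_of_lt (he' 0)] using this
    rw [h0] at h
    have h1 := Nat.eq_of_mul_eq_mul_left hp.out.pos (Nat.add_right_cancel h)
    have h2 := ih (fun i => e (i + 1)) (fun i => e' (i + 1)) (fun i => he _) (fun i => he' _) h1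
    intro i hi
    cases i with
    | zero => exact h0
    | succ i => exact h2 i (by omega)

/-- The product of the `x (i, j) ^ e (i, j)`. -/
def monoProd {R : Type*} [CommSemiring R] (x : ℕ × ℕ → R) (e : ℕ × ℕ →₀ ℕ) : R :=
  e.prod fun k n => x k ^ n

theorem map_monoProd {R S : Type*} [CommSemiring R] [CommSemiring S] (h : R →+* S)
    (x : ℕ × ℕ → R) (e : ℕ × ℕ →₀ ℕ) : h (monoProd x e) = monoProd (fun k => h (x k)) e := by
  simp [monoProd, Finsupp.prod, map_prod]

/-- The exponent of the leading monomial of a monomial in the `dPoly`. -/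
def leadExp (e : ℕ × ℕ →₀ ℕ) : ℕᵒᵈ →₀ ℕ :=
  e.sum fun k n => Finsupp.single (OrderDual.toDual k.2) (n * p ^ k.1)

theorem leadExp_injective : Function.Injective fun e : RedExp p => leadExp p e.1 := by
  classical
  rintro ⟨e, he⟩ ⟨e', he'⟩ h
  obtain ⟨N, hN⟩ : ∃ N, ∀ k ∈ e.support ∪ e'.support, k.1 < N ∧ k.2 < N := by
    refine ⟨(e.support ∪ e'.support).sup (fun k => k.1 + k.2) + 1, fun k hk => ?_⟩
    have : k.1 + k.2 ≤ _ := Finset.le_sup (f := fun k : ℕ × ℕ => k.1 + k.2) hk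
    omega
  have key : ∀ f : ℕ × ℕ →₀ ℕ, f.support ⊆ e.support ∪ e'.support → ∀ j,
      leadExp p f (OrderDual.toDual j) = ∑ i ∈ Finset.range N, f (i, j) * p ^ i := by
    intro f hf j
    rw [leadExp, Finsupp.sum_of_support_subset (s := Finset.range N ×ˢ Finset.range N) f
      (fun k hk => by simpa using hN k (hf hk)) _ (by simp), Finset.sum_product,
      Finsupp.finsetSum_apply]
    refine Finset.sum_congr rfl fun i hi => ?_
    rw [Finsupp.finsetSum_apply]
    simp only [Finsupp.single_apply, EmbeddingLike.apply_eq_iff_eq]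
    rw [Finset.sum_ite_eq']
    split_ifs with hj
    · rfl
    · have : f (i, j) = 0 := by
        by_contra h0
        exact hj (Finset.mem_range.2 (hN _ (hf (Finsupp.mem_support_iff.2 h0))).2)
      simp [this]
  refine Subtype.ext (Finsupp.ext fun ⟨i, j⟩ => ?_)
  have hj : leadExp p e (OrderDual.toDual j) = leadExp p e' (OrderDual.toDual j) :=
    DFunLike.congr_fun h (OrderDual.toDual j)
  rw [key e Finset.subset_union_left, key e' Finset.subset_union_right] at hj
  rcases lt_or_ge i N with hi | hi
  · exact digits_unique p N _ _ (fun i => he (i, j)) (fun i => he' (i, j)) hj i hi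
  · have h0 : ∀ f : ℕ × ℕ →₀ ℕ, f.support ⊆ e.support ∪ e'.support → f (i, j) = 0 := by
      intro f hf
      by_contra h0
      have := (hN _ (hf (Finsupp.mem_support_iff.2 h0))).1
      simp only at this
      omega
    change e (i, j) = e' (i, j)
    rw [h0 e Finset.subset_union_left, h0 e' Finset.subset_union_right]

theorem dPoly_monoProd_degree (e : ℕ × ℕ →₀ ℕ) :
    monoProd (fun k => dPoly p k.1 k.2) e ≠ 0 ∧
    MonomialOrder.degLex.degree (monoProd (fun k => dPoly p k.1 k.2) e) = leadExp p e := by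
  have hne : ∀ k ∈ e.support, dPoly p k.1 k.2 ^ e k ≠ 0 := fun k _ =>
    pow_ne_zero _ (dPoly_degree p k.1 k.2).1
  refine ⟨Finset.prod_ne_zero_iff.2 hne, ?_⟩
  rw [monoProd, Finsupp.prod, MonomialOrder.degree_prod hne, leadExp, Finsupp.sum]
  refine Finset.sum_congr rfl fun k _ => ?_
  rw [MonomialOrder.degree_pow, (dPoly_degree p k.1 k.2).2, Finsupp.smul_single, smul_eq_mul]

theorem dPoly_linearIndependent :
    LinearIndependent ℚ fun e : RedExp p => monoProd (fun k => dPoly p k.1 k.2) e.1 := by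
  rw [linearIndependent_iff]
  intro c hc
  by_contra hne
  obtain ⟨e, he, hmax⟩ := c.support.exists_max_image
    (fun e => MonomialOrder.degLex.toSyn (leadExp p e.1)) (Finsupp.support_nonempty_iff.2 hne)
  have h := congrArg (coeff (leadExp p e.1)) hc
  rw [Finsupp.linearCombination_apply, Finsupp.sum, coeff_sum,
    Finset.sum_eq_single_of_mem e he ?_] at h
  · rw [coeff_smul, coeff_zero, smul_eq_mul, mul_eq_zero] at h
    rcases h with h | h
    · exact Finsupp.mem_support_iff.1 he h
    · rw [← (dPoly_monoProd_degree p e.1).2] at h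
      exact (dPoly_monoProd_degree p e.1).1 (MonomialOrder.coeff_degree_eq_zero_iff.1 h)
  · intro e' he' hee'
    rw [coeff_smul, MonomialOrder.coeff_eq_zero_of_lt, smul_zero]
    rw [(dPoly_monoProd_degree p e'.1).2]
    refine lt_of_le_of_ne (hmax e' he') fun h => hee' ?_
    exact leadExp_injective p (MonomialOrder.degLex.toSyn.injective h)

/-- A rational polynomial that vanishes on all sequences of power sums `∑ x ^ (p ^ j)` is zero. -/
theorem eq_zero_of_powerSums (F : MvPolynomial ℕᵒᵈ ℚ)
    (hF : ∀ s : Multiset ℕ, eval (fun j : ℕᵒᵈ =>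
      (((s.map (· ^ p ^ (OrderDual.ofDual j))).sum : ℕ) : ℚ)) F = 0) : F = 0 := by
  obtain ⟨n, f, hf, G, rfl⟩ := exists_fin_rename F
  let c : Fin n → ℚ := fun j => 2 ^ p ^ (OrderDual.ofDual (f j))
  have hc : Function.Injective c := by
    intro i j hij
    have h1 := pow_right_injective₀ (a := (2 : ℚ)) (by norm_num) (by norm_num) hij
    have h2 := Nat.pow_right_injective hp.out.two_le h1
    exact hf (OrderDual.ofDual.injective h2)
  have hdet := Matrix.det_vandermonde_ne_zero_iff.2 hc
  let y : Fin n → MvPolynomial (Fin n) ℚ := fun j => ∑ k : Fin n, X k * C (c j ^ (k : ℕ))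
  have hev : ∀ z, eval z (bind₁ y G) = eval (fun j => eval z (y j)) G := fun z =>
    eval₂Hom_bind₁ _ _ _ _
  have hy : bind₁ y G = 0 := by
    refine funext_set (fun _ => Set.range ((↑) : ℕ → ℚ))
      (fun _ => Set.infinite_range_of_injective Nat.cast_injective) fun x hx => ?_
    choose m hm using fun k => hx k trivial
    have h := hF (∑ k : Fin n, m k • {2 ^ (k : ℕ)})
    rw [eval_rename] at h
    rw [map_zero, hev, ← h]
    congr 2
    funext j
    simp only [y, c, map_sum, map_mul, eval_X, eval_C, Function.comp_apply, ← hm]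
    have : ∀ t : Finset (Fin n), ((Multiset.map (fun x => x ^ p ^ OrderDual.ofDual (f j))
        (∑ k ∈ t, m k • ({2 ^ (k : ℕ)} : Multiset ℕ))).sum : ℕ) =
        ∑ k ∈ t, m k * (2 ^ p ^ OrderDual.ofDual (f j)) ^ (k : ℕ) := by
      classical
      intro t
      induction t using Finset.induction_on with
      | empty => simp
      | insert a t ha ih =>
        rw [Finset.sum_insert ha, Finset.sum_insert ha, Multiset.map_add, Multiset.sum_add, ih,
          Multiset.map_nsmul, Multiset.sum_nsmul]
        simp [← pow_mul, mul_comm]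
    rw [this]
    push_cast
    rfl
  have hG : G = 0 := by
    refine funext fun w => ?_
    obtain ⟨z, hz⟩ := (Matrix.mulVec_surjective_iff_isUnit.2
      ((Matrix.isUnit_iff_isUnit_det _).2 hdet.isUnit)) w
    have h := congrArg (eval z) hy
    rw [hev, map_zero] at h
    rw [map_zero, ← h, ← hz]
    congr 2
    funext j
    simp [y, Matrix.mulVec, dotProduct, Matrix.vandermonde_apply, mul_comm]
  rw [hG, map_zero]

theorem evalAt_dd (s : Multiset ℕ) (i j : ℕ) : ((evalAt s (dd p i j) : ℕ) : ℚ) =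
    eval (fun j : ℕᵒᵈ => (((s.map (· ^ p ^ (OrderDual.ofDual j))).sum : ℕ) : ℚ))
      (dPoly p i j) := by
  induction i generalizing j with
  | zero => rw [evalAt_dd_zero]; simp [dPoly]
  | succ i ih =>
    have h := congrArg (fun f => ((evalAt s f : ℕ) : ℚ)) (dd_rel p i j)
    simp only [map_add, map_mul, map_pow, map_natCast, Nat.cast_add, Nat.cast_mul, Nat.cast_pow,
      ih] at h
    have hp0 : (p : ℚ) ≠ 0 := Nat.cast_ne_zero.2 hp.out.ne_zero
    simp only [dPoly, map_mul, map_sub, map_pow, eval_C]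
    field_simp
    simp only [Nat.cast_id] at h
    linarith

/-- The reduced monomials in the `d_{i,j}` are linearly independent, even as functions of the
finite multisets of natural numbers. -/
theorem redMono_independent : LinearIndependent ℕ fun (e : RedExp p) (s : Multiset ℕ) =>
    evalAt s (monoProd (fun k => dd p k.1 k.2) e.1) := by
  intro a b hab
  have hQ : Function.Injective fun a : RedExp p →₀ ℕ => a.mapRange ((↑) : ℕ → ℚ) Nat.cast_zero :=
    Finsupp.mapRange_injective _ _ Nat.cast_injective
  apply hQ
  have hli := dPoly_linearIndependent p
  apply hli
  rw [← sub_eq_zero]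
  refine eq_zero_of_powerSums p _ fun s => ?_
  have key : ∀ a : RedExp p →₀ ℕ,
      eval (fun j : ℕᵒᵈ => (((s.map (· ^ p ^ (OrderDual.ofDual j))).sum : ℕ) : ℚ))
        (Finsupp.linearCombination ℚ (fun e : RedExp p => monoProd (fun k => dPoly p k.1 k.2) e.1)
          (a.mapRange ((↑) : ℕ → ℚ) Nat.cast_zero)) =
      ((Finsupp.linearCombination ℕ (fun (e : RedExp p) (s : Multiset ℕ) =>
        evalAt s (monoProd (fun k => dd p k.1 k.2) e.1)) a s : ℕ) : ℚ) := by
    intro a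
    rw [Finsupp.linearCombination_apply, Finsupp.sum_mapRange_index (by simp),
      Finsupp.linearCombination_apply, Finsupp.sum, Finsupp.sum, map_sum, Finset.sum_apply,
      Nat.cast_sum]
    refine Finset.sum_congr rfl fun e _ => ?_
    rw [smul_eval, map_monoProd, Pi.smul_apply, map_monoProd, smul_eq_mul, Nat.cast_mul]
    congr 1
    rw [← Nat.coe_castRingHom, map_monoProd]
    simp only [Nat.coe_castRingHom, evalAt_dd]
  rw [map_sub, key, key, hab, sub_self]

/-! ## The co-operations -/

/-- The generator `d_{i,j}` of the semiring of `p`-typical symmetric functions. -/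
def dGen (i j : ℕ) : PTypSymFun p := ⟨dd p i j, Subsemiring.subset_closure ⟨(i, j), rfl⟩⟩

/-- Evaluation of `p`-typical symmetric functions at a finite multiset. -/
def ev {R : Type*} [CommSemiring R] (s : Multiset R) : PTypSymFun p →+* R :=
  (evalAt s).comp (PTypSymFun p).subtype

theorem dGen_rel (i j : ℕ) : p * dGen p (i + 1) j + dGen p i (j + 1) = dGen p i j ^ p :=
  Subtype.ext (dd_rel p i j)

theorem map_ev {R S : Type*} [CommSemiring R] [CommSemiring S] (h : R →+* S)
    (s : Multiset R) (f : PTypSymFun p) : h (ev p s f) = ev p (s.map h) f :=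
  map_evalAt h s f.1

theorem ev_dGen_zero {R : Type*} [CommSemiring R] (s : Multiset R) (j : ℕ) :
    ev p s (dGen p 0 j) = (s.map (· ^ p ^ j)).sum :=
  evalAt_dd_zero p s j

variable {p} in
theorem mem_of_dGen_mem (S : Subsemiring (PTypSymFun p)) (h : ∀ i j, dGen p i j ∈ S)
    (x : PTypSymFun p) : x ∈ S := by
  have h1 : PTypSymFun p ≤ S.map (PTypSymFun p).subtype := by
    refine Subsemiring.closure_le.2 ?_
    rintro _ ⟨⟨i, j⟩, rfl⟩
    exact ⟨dGen p i j, h i j, rfl⟩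
  obtain ⟨y, hy, hyx⟩ := h1 x.2
  rwa [← Subtype.ext hyx]

variable {p} in
/-- A homomorphism to a cancellative semiring is determined by the values on the `ψ_{p^j}`. -/
theorem hom_ext_ghost {R : Type*} [CommSemiring R] (hR : PCancel p R) {a b : PTypSymFun p →+* R}
    (h : ∀ j, a (dGen p 0 j) = b (dGen p 0 j)) : a = b := by
  have key : ∀ i j, a (dGen p i j) = b (dGen p i j) := by
    intro i
    induction i with
    | zero => exact h
    | succ i ih =>
      intro j
      apply hR _ _ (a (dGen p i (j + 1)))
      have ha := congrArg a (dGen_rel p i j)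
      have hb := congrArg b (dGen_rel p i j)
      simp only [map_add, map_mul, map_pow, map_natCast] at ha hb
      rw [ha, ih (j + 1), hb, ih j]
  exact RingHom.ext fun x => mem_of_dGen_mem (RingHom.eqLocusS a b) key x

/-- The reduced monomials span. -/
theorem redMono_span : ⊤ ≤ Submodule.span ℕ
    (Set.range fun e : RedExp p => monoProd (fun k => dGen p k.1 k.2) e.1) := by
  classical
  have key : ∀ (n : ℕ) (e : ℕ × ℕ →₀ ℕ), e.degree = n →
      monoProd (fun k => dGen p k.1 k.2) e ∈ Submodule.span ℕ
        (Set.range fun e : RedExp p => monoProd (fun k => dGen p k.1 k.2) e.1) := by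
    intro n
    induction n using Nat.strong_induction_on with
    | _ n ih =>
    intro e he
    by_cases hred : ∀ k, e k < p
    · exact Submodule.subset_span ⟨⟨e, hred⟩, rfl⟩
    push Not at hred
    obtain ⟨⟨i, j⟩, hk⟩ := hred
    obtain ⟨e', rfl⟩ : ∃ e', e = e' + Finsupp.single (i, j) p := by
      refine ⟨e - Finsupp.single (i, j) p, (tsub_add_cancel_of_le ?_).symm⟩
      exact Finsupp.single_le_iff.2 hk
    have hmul : ∀ (k : ℕ × ℕ) (m : ℕ), monoProd (fun k => dGen p k.1 k.2)
        (e' + Finsupp.single k m) =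
        monoProd (fun k => dGen p k.1 k.2) e' * dGen p k.1 k.2 ^ m := by
      intro k m
      rw [monoProd, Finsupp.prod_add_index' (by simp) (by simp [pow_add]),
        Finsupp.prod_single_index (by simp)]
      rfl
    have hlt : ∀ k : ℕ × ℕ, (e' + Finsupp.single k 1).degree < n := by
      intro k
      rw [← he, map_add, map_add, Finsupp.degree_single, Finsupp.degree_single]
      exact Nat.add_lt_add_left hp.out.one_lt _
    have h1 := ih _ (hlt (i + 1, j)) _ rfl
    have h2 := ih _ (hlt (i, j + 1)) _ rfl
    rw [hmul, pow_one] at h1 h2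
    rw [hmul]
    simp only
    rw [← dGen_rel, mul_add, mul_left_comm, ← nsmul_eq_mul]
    exact add_mem (nsmul_mem h1 p) h2
  intro x _
  have hsurj : ∃ q : MvPolynomial (ℕ × ℕ) ℕ, natEval (fun k => dGen p k.1 k.2) q = x :=
    mem_of_dGen_mem (RingHom.rangeS (natEval fun k : ℕ × ℕ => dGen p k.1 k.2))
      (fun i j => ⟨X (i, j), by simp⟩) x
  obtain ⟨q, rfl⟩ := hsurj
  induction q using natPoly_induction with
  | h0 => rw [map_zero]; exact zero_mem _
  | hadd q r hq hr => rw [map_add]; exact add_mem (hq trivial) (hr trivial)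
  | hm α =>
    have := key _ α rfl
    rwa [coe_eval₂Hom, eval₂_monomial, map_one, one_mul]

theorem ev_redMono (s : Multiset ℕ) (e : RedExp p) :
    ev p s (monoProd (fun k => dGen p k.1 k.2) e.1) =
      evalAt s (monoProd (fun k => dd p k.1 k.2) e.1) := by
  rw [map_monoProd, map_monoProd]; rfl

theorem redMono_linearIndependent :
    LinearIndependent ℕ fun e : RedExp p => monoProd (fun k => dGen p k.1 k.2) e.1 := by
  refine LinearIndependent.of_comp
    (AddMonoidHom.toNatLinearMap (RingHom.pi fun s : Multiset ℕ => ev p s).toAddMonoidHom) ?_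
  convert redMono_independent p using 2 with e
  funext s
  exact ev_redMono p s e

/-- The basis of reduced monomials. -/
def redBasis : Module.Basis (RedExp p) ℕ (PTypSymFun p) :=
  Module.Basis.mk (redMono_linearIndependent p) (redMono_span p)

/-- Freeness of the additive monoid. -/
def FreeNat (R : Type) [AddCommMonoid R] : Prop :=
  ∃ ι : Type, Nonempty (R ≃+ (ι →₀ ℕ))

theorem FreeNat.pCancel {p : ℕ} (hp : p ≠ 0) {R : Type} [CommSemiring R] (h : FreeNat R) :
    PCancel p R := by
  obtain ⟨ι, ⟨e⟩⟩ := h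
  exact PCancel.of_injective hp (Finsupp.coeFnAddHom.comp e.toAddMonoidHom)
    (DFunLike.coe_injective.comp e.injective)

theorem FreeNat.tensor {S S' : Type} [CommSemiring S] [CommSemiring S'] (h : FreeNat S)
    (h' : FreeNat S') : FreeNat (S ⊗[ℕ] S') := by
  obtain ⟨ι, ⟨e⟩⟩ := h
  obtain ⟨ι', ⟨e'⟩⟩ := h'
  let b : Module.Basis ι ℕ S := Module.Basis.ofRepr e.toNatLinearEquiv
  let b' : Module.Basis ι' ℕ S' := Module.Basis.ofRepr e'.toNatLinearEquiv
  exact ⟨_, ⟨(b.tensorProduct b').repr.toAddEquiv⟩⟩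

theorem freeNat_pTypSymFun : FreeNat (PTypSymFun p) := ⟨_, ⟨(redBasis p).repr.toAddEquiv⟩⟩

/-- The homomorphism `x ⊗ y ↦ a x * b y`. -/
def pair {S S' A : Type*} [CommSemiring S] [CommSemiring S'] [CommSemiring A] (a : S →+* A) (b : S' →+* A) : S ⊗[ℕ] S' →+* A :=
  (Algebra.TensorProduct.productMap a.toNatAlgHom b.toNatAlgHom).toRingHom

theorem pair_tmul {S S' A : Type*} [CommSemiring S] [CommSemiring S'] [CommSemiring A] (a : S →+* A) (b : S' →+* A) (x : S) (y : S') :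
    pair a b (x ⊗ₜ y) = a x * b y :=
  Algebra.TensorProduct.productMap_apply_tmul _ _ x y

theorem tensorHom_ext {S S' A : Type*} [CommSemiring S] [CommSemiring S'] [CommSemiring A] {f g : S ⊗[ℕ] S' →+* A}
    (h : ∀ x y, f (x ⊗ₜ y) = g (x ⊗ₜ y)) : f = g := by
  refine RingHom.ext fun z => ?_
  induction z using TensorProduct.induction_on with
  | zero => rw [map_zero, map_zero]
  | tmul x y => exact h x y
  | add x y hx hy => rw [map_add, map_add, hx, hy]

theorem comp_pair {S S' A B : Type*} [CommSemiring S] [CommSemiring S'] [CommSemiring A]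
    [CommSemiring B] (h : A →+* B) (a : S →+* A) (b : S' →+* A) :
    h.comp (pair a b) = pair (h.comp a) (h.comp b) :=
  tensorHom_ext fun x y => by simp [pair_tmul]

/-- Elements of the tensor square are determined by their values at finite multisets of natural
numbers. -/
theorem tensor_ext {u v : PTypSymFun p ⊗[ℕ] PTypSymFun p}
    (h : ∀ s t : Multiset ℕ, pair (ev p s) (ev p t) u = pair (ev p s) (ev p t) v) : u = v := by
  classical
  let b := redBasis p
  let B := b.tensorProduct b
  let m : RedExp p → Multiset ℕ → ℕ := fun e s =>
    evalAt s (monoProd (fun k => dd p k.1 k.2) e.1)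
  have hbm : ∀ e s, ev p s (b e) = m e s := fun e s => by
    rw [show b e = _ from Module.Basis.mk_apply _ _ e, ev_redMono]
  let E : Multiset ℕ → (RedExp p →₀ ℕ) →+ ℕ := fun t =>
    { toFun := fun a => Finsupp.linearCombination ℕ m a t
      map_zero' := by simp
      map_add' := fun x y => by simp }
  have key : ∀ (c : RedExp p × RedExp p →₀ ℕ) (s t : Multiset ℕ),
      pair (ev p s) (ev p t) (Finsupp.linearCombination ℕ B c) =
      Finsupp.linearCombination ℕ m (Finsupp.mapRange (E t) (map_zero _) c.curry) s := by
    intro c s t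
    induction c using Finsupp.induction_linear with
    | zero =>
      have h0 : (0 : RedExp p × RedExp p →₀ ℕ).curry = 0 := by ext; simp
      simp [h0]
    | add f g hf hg =>
      have h0 : (f + g).curry = f.curry + g.curry := by ext; simp
      rw [map_add, map_add, hf, hg, h0, Finsupp.mapRange_add (map_add (E t)),
        map_add, Pi.add_apply]
    | single kl n =>
      obtain ⟨k, l⟩ := kl
      rw [Finsupp.curry_single, Finsupp.mapRange_single, Finsupp.linearCombination_single,
        Finsupp.linearCombination_single, map_nsmul, Module.Basis.tensorProduct_apply, pair_tmul,
        hbm, hbm]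
      simp only [E, AddMonoidHom.coe_mk, ZeroHom.coe_mk, Finsupp.linearCombination_single,
        Pi.smul_apply, smul_eq_mul]
      ring
  have hu := B.linearCombination_repr u
  have hv := B.linearCombination_repr v
  have hcurry : (B.repr u).curry = (B.repr v).curry := by
    refine Finsupp.ext fun k => redMono_independent p (funext fun t => ?_)
    have h1 : Finsupp.mapRange (E t) (map_zero _) (B.repr u).curry =
        Finsupp.mapRange (E t) (map_zero _) (B.repr v).curry := by
      refine redMono_independent p (funext fun s => ?_)
      have := h s t
      rw [← hu, ← hv] at this
      exact (key _ s t).symm.trans (this.trans (key _ s t))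
    exact DFunLike.congr_fun h1 k
  have : B.repr u = B.repr v := Finsupp.ext fun ⟨k, l⟩ => by
    have := DFunLike.congr_fun (DFunLike.congr_fun hcurry k) l
    simpa using this
  exact B.repr.injective this

/-- `ψ ∘ ·` preserves the `p`-typical symmetric functions. -/
theorem psi_mem (x : PTypSymFun p) : adams p x.1 ∈ PTypSymFun p := by
  refine mem_of_dGen_mem ((PTypSymFun p).comap ((adams p).comp (PTypSymFun p).subtype)) ?_ x
  exact fun i j => Subsemiring.mem_comap.2 (Subsemiring.subset_closure ⟨(i, j + 1),
    (psi_dd p i j).symm⟩)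

/-- The endomorphism `ψ ∘ ·` of the semiring of `p`-typical symmetric functions. -/
def adamsP : PTypSymFun p →+* PTypSymFun p :=
  ((adams p).comp (PTypSymFun p).subtype).codRestrict (PTypSymFun p) (psi_mem p)

theorem adamsP_dGen (i j : ℕ) : adamsP p (dGen p i j) = dGen p i (j + 1) :=
  Subtype.ext (psi_dd p i j)

theorem ev_adamsP {R : Type*} [CommSemiring R] (s : Multiset R) (x : PTypSymFun p) :
    ev p s (adamsP p x) = ev p (s.map (· ^ p)) x :=
  evalAt_adams p s x.1

/-- The endomorphism `ψ ⊗ ψ`. -/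
def adamsT : PTypSymFun p ⊗[ℕ] PTypSymFun p →+* PTypSymFun p ⊗[ℕ] PTypSymFun p :=
  (Algebra.TensorProduct.map (adamsP p).toNatAlgHom (adamsP p).toNatAlgHom).toRingHom

theorem adamsT_tmul (x y : PTypSymFun p) : adamsT p (x ⊗ₜ y) = adamsP p x ⊗ₜ adamsP p y := rfl

theorem pair_adamsT (s t : Multiset ℕ) (u : PTypSymFun p ⊗[ℕ] PTypSymFun p) :
    pair (ev p s) (ev p t) (adamsT p u) =
      pair (ev p (s.map (· ^ p))) (ev p (t.map (· ^ p))) u := by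
  refine DFunLike.congr_fun (tensorHom_ext (f := (pair (ev p s) (ev p t)).comp (adamsT p))
    fun x y => ?_) u
  rw [RingHom.comp_apply, adamsT_tmul, pair_tmul, pair_tmul, ev_adamsP, ev_adamsP]

theorem frob_tensor (u : PTypSymFun p ⊗[ℕ] PTypSymFun p) :
    ∃ b, u ^ p = (p : PTypSymFun p ⊗[ℕ] PTypSymFun p) * b + adamsT p u := by
  have h1 : ∀ x : PTypSymFun p, ∃ b, x ^ p = (p : PTypSymFun p) * b + adamsP p x :=
    mem_of_dGen_mem (frobSubsemiring p (adamsP p)) fun i j =>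
      ⟨dGen p (i + 1) j, by rw [adamsP_dGen, dGen_rel]⟩
  change u ∈ frobSubsemiring p (adamsT p)
  induction u using TensorProduct.induction_on with
  | zero => exact zero_mem _
  | add x y hx hy => exact add_mem hx hy
  | tmul x y =>
    have hx : x ⊗ₜ[ℕ] (1 : PTypSymFun p) ∈ frobSubsemiring p (adamsT p) := by
      obtain ⟨b, hb⟩ := h1 x
      refine ⟨b ⊗ₜ 1, ?_⟩
      rw [Algebra.TensorProduct.tmul_pow, one_pow, hb, adamsT_tmul, map_one, TensorProduct.add_tmul,
        ← nsmul_eq_mul, ← nsmul_eq_mul]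
      rfl
    have hy : (1 : PTypSymFun p) ⊗ₜ[ℕ] y ∈ frobSubsemiring p (adamsT p) := by
      obtain ⟨b, hb⟩ := h1 y
      refine ⟨1 ⊗ₜ b, ?_⟩
      rw [Algebra.TensorProduct.tmul_pow, one_pow, hb, adamsT_tmul, map_one, TensorProduct.tmul_add,
        ← nsmul_eq_mul, ← nsmul_eq_mul, TensorProduct.tmul_smul]
    have := mul_mem hx hy
    rwa [Algebra.TensorProduct.tmul_mul_tmul, mul_one, one_mul] at this

/-- Existence of a co-operation whose values at multisets of natural numbers are prescribed. -/
theorem exists_coop (op : Multiset ℕ → Multiset ℕ → Multiset ℕ)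
    (hop : ∀ s t, op (s.map (· ^ p)) (t.map (· ^ p)) = (op s t).map (· ^ p))
    (c : PTypSymFun p ⊗[ℕ] PTypSymFun p)
    (hc : ∀ s t, pair (ev p s) (ev p t) c = (op s t).sum) :
    ∃ Δ : PTypSymFun p →+* PTypSymFun p ⊗[ℕ] PTypSymFun p,
      ∀ f s t, pair (ev p s) (ev p t) (Δ f) = ev p (op s t) f := by
  let S : Subsemiring (PTypSymFun p) :=
    { carrier := {f | ∃ u, ∀ s t, pair (ev p s) (ev p t) u = ev p (op s t) f}
      zero_mem' := ⟨0, fun s t => by rw [map_zero, map_zero]⟩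
      one_mem' := ⟨1, fun s t => by rw [map_one, map_one]⟩
      add_mem' := by
        rintro f g ⟨u, hu⟩ ⟨v, hv⟩
        exact ⟨u + v, fun s t => by rw [map_add, map_add, hu, hv]⟩
      mul_mem' := by
        rintro f g ⟨u, hu⟩ ⟨v, hv⟩
        exact ⟨u * v, fun s t => by rw [map_mul, map_mul, hu, hv]⟩ }
  have h0 : ∀ j, dGen p 0 j ∈ S := by
    intro j
    induction j with
    | zero => exact ⟨c, fun s t => by rw [hc, ev_dGen_zero]; simp⟩
    | succ j ih =>
      obtain ⟨u, hu⟩ := ih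
      exact ⟨adamsT p u, fun s t => by rw [pair_adamsT, hu, hop, ← adamsP_dGen, ev_adamsP]⟩
  have hS : ∀ i j, dGen p i j ∈ S := by
    intro i
    induction i with
    | zero => exact h0
    | succ i ih =>
      intro j
      obtain ⟨u, hu⟩ := ih j
      obtain ⟨b, hb⟩ := frob_tensor p u
      refine ⟨b, fun s t => ?_⟩
      have h1 := congrArg (pair (ev p s) (ev p t)) hb
      have h2 := congrArg (ev p (op s t)) (dGen_rel p i j)
      rw [map_add, map_mul, map_pow, map_natCast] at h1 h2
      rw [pair_adamsT, hu, hu, hop, ← ev_adamsP, adamsP_dGen, ← h2] at h1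
      exact (Nat.eq_of_mul_eq_mul_left hp.out.pos (Nat.add_right_cancel h1)).symm
  choose F hF using mem_of_dGen_mem S hS
  exact ⟨{ toFun := F
           map_zero' := tensor_ext p fun s t => by rw [hF, map_zero, map_zero]
           map_one' := tensor_ext p fun s t => by rw [hF, map_one, map_one]
           map_add' := fun f g => tensor_ext p fun s t => by
             rw [hF, map_add, map_add, hF, hF]
           map_mul' := fun f g => tensor_ext p fun s t => by
             rw [hF, map_mul, map_mul, hF, hF] }, hF⟩

/-- The first alphabet `x_1, …, x_m`. -/
def alphX (m n : ℕ) : Multiset (MvPolynomial (Fin m ⊕ Fin n) ℕ) :=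
  Finset.univ.val.map fun i => X (Sum.inl i)

/-- The second alphabet `y_1, …, y_n`. -/
def alphY (m n : ℕ) : Multiset (MvPolynomial (Fin m ⊕ Fin n) ℕ) :=
  Finset.univ.val.map fun j => X (Sum.inr j)

/-- The multiset of all products `r * r'` with `r ∈ s` and `r' ∈ t`. -/
def mulMultiset {R : Type*} [Mul R] (s t : Multiset R) : Multiset R :=
  (s ×ˢ t).map fun q => q.1 * q.2

/-- The condition that `Δ` is the co-addition `f(…, x_i, …) ↦ f(…, x_i ⊗ 1, 1 ⊗ x_i, …)`: an
element `∑ g ⊗ h` of the tensor square stands for the function `∑ g(x) h(y)` of two alphabets. -/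
def IsCoadd (Δ : PTypSymFun p →+* PTypSymFun p ⊗[ℕ] PTypSymFun p) : Prop :=
  ∀ f m n, pair (ev p (alphX m n)) (ev p (alphY m n)) (Δ f) = ev p (alphX m n + alphY m n) f

/-- The condition that `Δ` is the co-multiplication `f(…, x_i, …) ↦ f(…, x_i ⊗ x_j, …)`. -/
def IsComul (Δ : PTypSymFun p →+* PTypSymFun p ⊗[ℕ] PTypSymFun p) : Prop :=
  ∀ f m n, pair (ev p (alphX m n)) (ev p (alphY m n)) (Δ f) =
    ev p (mulMultiset (alphX m n) (alphY m n)) f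

theorem mulMultiset_map {R S : Type*} [CommMonoid R] [CommMonoid S] (h : R →* S)
    (s t : Multiset R) : mulMultiset (s.map h) (t.map h) = (mulMultiset s t).map h := by
  simp only [mulMultiset, Multiset.map_map]
  induction s using Multiset.induction_on with
  | empty => simp
  | cons a s ih => simp [ih, Multiset.map_map]

theorem mulMultiset_sum {R : Type*} [CommSemiring R] (s t : Multiset R) :
    (mulMultiset s t).sum = s.sum * t.sum := by
  simp only [mulMultiset]
  induction s using Multiset.induction_on with
  | empty => simp
  | cons a s ih =>
    rw [Multiset.cons_product, Multiset.map_add, Multiset.sum_add, ih, Multiset.sum_cons, add_mul,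
      Multiset.map_map]
    congr 1
    exact Multiset.sum_map_mul_left (f := fun x => x)  |>.trans (by rw [Multiset.map_id'])

theorem pair_comp_ev {R S : Type*} [CommSemiring R] [CommSemiring S] (h : R →+* S)
    (s t : Multiset R) (u : PTypSymFun p ⊗[ℕ] PTypSymFun p) :
    h (pair (ev p s) (ev p t) u) = pair (ev p (s.map h)) (ev p (t.map h)) u := by
  have h1 : ∀ s : Multiset R, h.comp (ev p s) = ev p (s.map h) := fun s =>
    RingHom.ext fun f => map_ev p h s f
  rw [← h1, ← h1, ← comp_pair]; rfl

theorem exists_specialization (s t : Multiset ℕ) :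
    ∃ (m n : ℕ) (h : MvPolynomial (Fin m ⊕ Fin n) ℕ →+* ℕ),
      (alphX m n).map h = s ∧ (alphY m n).map h = t := by
  obtain ⟨m, y, rfl⟩ := exists_eq_map_univ s
  obtain ⟨n, z, rfl⟩ := exists_eq_map_univ t
  refine ⟨m, n, natEval (Sum.elim y z), ?_, ?_⟩
  · rw [alphX, Multiset.map_map]; congr 1; funext i; simp
  · rw [alphY, Multiset.map_map]; congr 1; funext i; simp

/-- The tensor square as functions of two alphabets. -/
theorem tensor_ext_alph {u v : PTypSymFun p ⊗[ℕ] PTypSymFun p}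
    (h : ∀ m n, pair (ev p (alphX m n)) (ev p (alphY m n)) u =
      pair (ev p (alphX m n)) (ev p (alphY m n)) v) : u = v := by
  refine tensor_ext p fun s t => ?_
  obtain ⟨m, n, g, rfl, rfl⟩ := exists_specialization s t
  rw [← pair_comp_ev, ← pair_comp_ev, h]

theorem exists_unique_coadd : ∃! Δ, IsCoadd p Δ := by
  obtain ⟨Δ, hΔ⟩ := exists_coop p (fun s t => s + t) (fun s t => by rw [Multiset.map_add])
    (dGen p 0 0 ⊗ₜ 1 + 1 ⊗ₜ dGen p 0 0)
    (fun s t => by rw [map_add, pair_tmul, pair_tmul, ev_dGen_zero, ev_dGen_zero]; simp)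
  have h0 : ∀ j, Δ (dGen p 0 j) = dGen p 0 j ⊗ₜ 1 + 1 ⊗ₜ dGen p 0 j := fun j =>
    tensor_ext p fun s t => by
      rw [hΔ, map_add, pair_tmul, pair_tmul, ev_dGen_zero, ev_dGen_zero, ev_dGen_zero]; simp
  refine ⟨Δ, fun f m n => ?_, fun Δ' hΔ' => RingHom.ext fun f => ?_⟩
  · refine DFunLike.congr_fun (hom_ext_ghost (PCancel.mvPolynomial hp.out.ne_zero _)
      (a := (pair (ev p (alphX m n)) (ev p (alphY m n))).comp Δ) fun j => ?_) f
    rw [RingHom.comp_apply, h0, map_add, pair_tmul, pair_tmul, ev_dGen_zero, ev_dGen_zero,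
      ev_dGen_zero, map_one, map_one, mul_one, one_mul, Multiset.map_add, Multiset.sum_add]
  · refine tensor_ext p fun s t => ?_
    rw [hΔ]
    obtain ⟨m, n, g, rfl, rfl⟩ := exists_specialization s t
    rw [← pair_comp_ev, hΔ', map_ev, Multiset.map_add]

theorem exists_unique_comul : ∃! Δ, IsComul p Δ := by
  obtain ⟨Δ, hΔ⟩ := exists_coop p mulMultiset
    (fun s t => mulMultiset_map (powMonoidHom p) s t) (dGen p 0 0 ⊗ₜ dGen p 0 0)
    (fun s t => by rw [pair_tmul, ev_dGen_zero, ev_dGen_zero, mulMultiset_sum]; simp)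
  have h0 : ∀ j, Δ (dGen p 0 j) = dGen p 0 j ⊗ₜ dGen p 0 j := fun j =>
    tensor_ext p fun s t => by
      rw [hΔ, pair_tmul, ev_dGen_zero, ev_dGen_zero, ev_dGen_zero, ← mulMultiset_sum]
      exact congrArg Multiset.sum (mulMultiset_map (powMonoidHom (p ^ j)) s t).symm
  refine ⟨Δ, fun f m n => ?_, fun Δ' hΔ' => RingHom.ext fun f => ?_⟩
  · refine DFunLike.congr_fun (hom_ext_ghost (PCancel.mvPolynomial hp.out.ne_zero _)
      (a := (pair (ev p (alphX m n)) (ev p (alphY m n))).comp Δ) fun j => ?_) f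
    rw [RingHom.comp_apply, h0, pair_tmul, ev_dGen_zero, ev_dGen_zero,
      ev_dGen_zero, ← mulMultiset_sum]
    exact congrArg Multiset.sum (mulMultiset_map (powMonoidHom (p ^ j))
      (alphX m n) (alphY m n))
  · refine tensor_ext p fun s t => ?_
    rw [hΔ]
    obtain ⟨m, n, g, rfl, rfl⟩ := exists_specialization s t
    rw [← pair_comp_ev, hΔ', map_ev]
    congr 1
    exact congrArg (ev p) (mulMultiset_map g.toMonoidHom (alphX m n) (alphY m n)).symm

/-- The co-addition `Δ⁺`. -/
def coadd : PTypSymFun p →+* PTypSymFun p ⊗[ℕ] PTypSymFun p := (exists_unique_coadd p).choose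

theorem coadd_spec : IsCoadd p (coadd p) := (exists_unique_coadd p).choose_spec.1

/-- The co-multiplication `Δ^×`. -/
def comul : PTypSymFun p →+* PTypSymFun p ⊗[ℕ] PTypSymFun p := (exists_unique_comul p).choose

theorem comul_spec : IsComul p (comul p) := (exists_unique_comul p).choose_spec.1

/-- The additive co-unit `f ↦ f(0, 0, …)`. -/
def counitAdd : PTypSymFun p →+* ℕ := ev p 0

/-- The multiplicative co-unit `f ↦ f(1, 0, 0, …)`. -/
def counitMul : PTypSymFun p →+* ℕ := ev p {1}

theorem coadd_dGen_zero (j : ℕ) : coadd p (dGen p 0 j) = dGen p 0 j ⊗ₜ 1 + 1 ⊗ₜ dGen p 0 j :=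
  tensor_ext_alph p fun m n => by
    rw [coadd_spec, map_add, pair_tmul, pair_tmul, ev_dGen_zero, ev_dGen_zero, ev_dGen_zero]; simp

theorem comul_dGen_zero (j : ℕ) : comul p (dGen p 0 j) = dGen p 0 j ⊗ₜ dGen p 0 j :=
  tensor_ext_alph p fun m n => by
    rw [comul_spec, pair_tmul, ev_dGen_zero, ev_dGen_zero, ev_dGen_zero, ← mulMultiset_sum]
    exact congrArg Multiset.sum (mulMultiset_map (powMonoidHom (p ^ j))
      (alphX m n) (alphY m n)).symm

/-! ## The semiring of `p`-typical Witt vectors -/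

/-- The set `W_(p)(A)` of `p`-typical Witt vectors with entries in a semiring `A`: the semiring
homomorphisms from `Λ_{ℕ,(p)}` to `A`. -/
def PTypWitt (A : Type*) [CommSemiring A] : Type _ := PTypSymFun p →+* A

namespace PTypWitt

variable {p} {A B : Type*} [CommSemiring A] [CommSemiring B]

/-- A Witt vector, as a homomorphism. -/
def hom (a : PTypWitt p A) : PTypSymFun p →+* A := a

/-- A homomorphism, as a Witt vector. -/
def mk (a : PTypSymFun p →+* A) : PTypWitt p A := a

theorem hom_ext {a b : PTypWitt p A} (h : a.hom = b.hom) : a = b := h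

/-- The sum of Witt vectors is induced by the co-addition. -/
instance : Add (PTypWitt p A) := ⟨fun a b => mk ((pair a.hom b.hom).comp (coadd p))⟩

/-- The product of Witt vectors is induced by the co-multiplication. -/
instance : Mul (PTypWitt p A) := ⟨fun a b => mk ((pair a.hom b.hom).comp (comul p))⟩

instance : Zero (PTypWitt p A) := ⟨mk ((Nat.castRingHom A).comp (counitAdd p))⟩

instance : One (PTypWitt p A) := ⟨mk ((Nat.castRingHom A).comp (counitMul p))⟩

/-- The entry `a_{i,j} = a(d_{i,j})`. -/
def entry (a : PTypWitt p A) (i j : ℕ) : A := a.hom (dGen p i j)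

/-- Functoriality. -/
def map (h : A →+* B) (a : PTypWitt p A) : PTypWitt p B := mk (h.comp a.hom)

theorem map_add' (h : A →+* B) (a b : PTypWitt p A) : map h (a + b) = map h a + map h b :=
  hom_ext (by
    change h.comp ((pair a.hom b.hom).comp (coadd p)) =
      (pair (h.comp a.hom) (h.comp b.hom)).comp (coadd p)
    rw [← comp_pair, RingHom.comp_assoc])

theorem map_mul' (h : A →+* B) (a b : PTypWitt p A) : map h (a * b) = map h a * map h b :=
  hom_ext (by
    change h.comp ((pair a.hom b.hom).comp (comul p)) =
      (pair (h.comp a.hom) (h.comp b.hom)).comp (comul p)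
    rw [← comp_pair, RingHom.comp_assoc])

theorem map_zero' (h : A →+* B) : map h (0 : PTypWitt p A) = 0 :=
  hom_ext (RingHom.ext fun _ => map_natCast h _)

theorem map_one' (h : A →+* B) : map h (1 : PTypWitt p A) = 1 :=
  hom_ext (RingHom.ext fun _ => map_natCast h _)

theorem add_entry (a b : PTypWitt p A) (j : ℕ) :
    (a + b).entry 0 j = a.entry 0 j + b.entry 0 j := by
  change pair a.hom b.hom (coadd p (dGen p 0 j)) = _
  rw [coadd_dGen_zero, _root_.map_add, pair_tmul, pair_tmul, map_one, map_one, mul_one, one_mul]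
  rfl

theorem mul_entry (a b : PTypWitt p A) (j : ℕ) :
    (a * b).entry 0 j = a.entry 0 j * b.entry 0 j := by
  change pair a.hom b.hom (comul p (dGen p 0 j)) = _
  rw [comul_dGen_zero, pair_tmul]
  rfl

theorem zero_entry (j : ℕ) : (0 : PTypWitt p A).entry 0 j = 0 := by
  change ((ev p 0 (dGen p 0 j) : ℕ) : A) = 0
  rw [ev_dGen_zero]; simp

theorem one_entry (j : ℕ) : (1 : PTypWitt p A).entry 0 j = 1 := by
  change ((ev p {1} (dGen p 0 j) : ℕ) : A) = 1
  rw [ev_dGen_zero]; simp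

/-- The tensor square, as a semiring. -/
def Square (p : ℕ) [Fact p.Prime] : Type := PTypSymFun p ⊗[ℕ] PTypSymFun p

instance : CommSemiring (Square p) :=
  inferInstanceAs (CommSemiring (PTypSymFun p ⊗[ℕ] PTypSymFun p))

theorem freeNat_square : FreeNat (Square p) :=
  FreeNat.tensor (freeNat_pTypSymFun p) (freeNat_pTypSymFun p)

/-- The semiring in which three independent Witt vectors live. -/
abbrev Triple (p : ℕ) [Fact p.Prime] : Type := Square p ⊗[ℕ] PTypSymFun p

theorem ghost_ext {a b : PTypWitt p (Triple p)} (h : ∀ j, a.entry 0 j = b.entry 0 j) : a = b :=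
  hom_ext (hom_ext_ghost ((freeNat_square.tensor (freeNat_pTypSymFun p)).pCancel hp.out.ne_zero) h)

theorem exists_universal : ∃ u v w : PTypWitt p (Triple p),
    ∀ a b c : PTypWitt p A, ∃ h : Triple p →+* A, map h u = a ∧ map h v = b ∧ map h w = c := by
  let iL : Square p →+* Triple p := Algebra.TensorProduct.includeLeftRingHom
  let iR : PTypSymFun p →+* Triple p := (Algebra.TensorProduct.includeRight (R := ℕ)).toRingHom
  let jL : PTypSymFun p →+* Square p :=
    (Algebra.TensorProduct.includeLeftRingHom :
      PTypSymFun p →+* PTypSymFun p ⊗[ℕ] PTypSymFun p)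
  let jR : PTypSymFun p →+* Square p :=
    (Algebra.TensorProduct.includeRight (R := ℕ) (A := PTypSymFun p)
      (B := PTypSymFun p)).toRingHom
  refine ⟨mk (iL.comp jL), mk (iL.comp jR), mk iR, fun a b c => ?_⟩
  let q : Square p →+* A := pair a.hom b.hom
  have hL : ∀ f, q (jL f) = a.hom f := fun f => (pair_tmul a.hom b.hom f 1).trans (by simp)
  have hR : ∀ f, q (jR f) = b.hom f := fun f => (pair_tmul a.hom b.hom 1 f).trans (by simp)
  refine ⟨pair q c.hom, hom_ext (RingHom.ext fun f => ?_), hom_ext (RingHom.ext fun f => ?_),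
    hom_ext (RingHom.ext fun f => ?_)⟩
  · exact (pair_tmul q c.hom (jL f) 1).trans (by rw [hL, map_one, mul_one])
  · exact (pair_tmul q c.hom (jR f) 1).trans (by rw [hR, map_one, mul_one])
  · exact (pair_tmul q c.hom 1 f).trans (by rw [map_one, one_mul])

/-- The semiring structure on the `p`-typical Witt vectors. -/
instance : CommSemiring (PTypWitt p A) where
  add_assoc a b c := by
    obtain ⟨u, v, w, H⟩ := exists_universal (p := p) (A := A)
    obtain ⟨h, rfl, rfl, rfl⟩ := H a b c
    simp only [← map_add']
    exact congrArg _ (ghost_ext fun j => by simp only [add_entry, add_assoc])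
  zero_add a := by
    obtain ⟨u, v, w, H⟩ := exists_universal (p := p) (A := A)
    obtain ⟨h, rfl, -, -⟩ := H a a a
    rw [← map_zero' h, ← map_add']
    exact congrArg _ (ghost_ext fun j => by simp only [add_entry, zero_entry, zero_add])
  add_zero a := by
    obtain ⟨u, v, w, H⟩ := exists_universal (p := p) (A := A)
    obtain ⟨h, rfl, -, -⟩ := H a a a
    rw [← map_zero' h, ← map_add']
    exact congrArg _ (ghost_ext fun j => by simp only [add_entry, zero_entry, add_zero])
  add_comm a b := by
    obtain ⟨u, v, w, H⟩ := exists_universal (p := p) (A := A)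
    obtain ⟨h, rfl, rfl, -⟩ := H a b a
    simp only [← map_add']
    exact congrArg _ (ghost_ext fun j => by simp only [add_entry, add_comm])
  mul_assoc a b c := by
    obtain ⟨u, v, w, H⟩ := exists_universal (p := p) (A := A)
    obtain ⟨h, rfl, rfl, rfl⟩ := H a b c
    simp only [← map_mul']
    exact congrArg _ (ghost_ext fun j => by simp only [mul_entry, mul_assoc])
  one_mul a := by
    obtain ⟨u, v, w, H⟩ := exists_universal (p := p) (A := A)
    obtain ⟨h, rfl, -, -⟩ := H a a a
    rw [← map_one' h, ← map_mul']
    exact congrArg _ (ghost_ext fun j => by simp only [mul_entry, one_entry, one_mul])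
  mul_one a := by
    obtain ⟨u, v, w, H⟩ := exists_universal (p := p) (A := A)
    obtain ⟨h, rfl, -, -⟩ := H a a a
    rw [← map_one' h, ← map_mul']
    exact congrArg _ (ghost_ext fun j => by simp only [mul_entry, one_entry, mul_one])
  mul_comm a b := by
    obtain ⟨u, v, w, H⟩ := exists_universal (p := p) (A := A)
    obtain ⟨h, rfl, rfl, -⟩ := H a b a
    simp only [← map_mul']
    exact congrArg _ (ghost_ext fun j => by simp only [mul_entry, mul_comm])
  zero_mul a := by
    obtain ⟨u, v, w, H⟩ := exists_universal (p := p) (A := A)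
    obtain ⟨h, rfl, -, -⟩ := H a a a
    rw [← map_zero' h, ← map_mul']
    exact congrArg _ (ghost_ext fun j => by simp only [mul_entry, zero_entry, zero_mul])
  mul_zero a := by
    obtain ⟨u, v, w, H⟩ := exists_universal (p := p) (A := A)
    obtain ⟨h, rfl, -, -⟩ := H a a a
    rw [← map_zero' h, ← map_mul']
    exact congrArg _ (ghost_ext fun j => by simp only [mul_entry, zero_entry, mul_zero])
  left_distrib a b c := by
    obtain ⟨u, v, w, H⟩ := exists_universal (p := p) (A := A)
    obtain ⟨h, rfl, rfl, rfl⟩ := H a b c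
    simp only [← map_mul', ← map_add']
    exact congrArg _ (ghost_ext fun j => by simp only [mul_entry, add_entry, mul_add])
  right_distrib a b c := by
    obtain ⟨u, v, w, H⟩ := exists_universal (p := p) (A := A)
    obtain ⟨h, rfl, rfl, rfl⟩ := H a b c
    simp only [← map_mul', ← map_add']
    exact congrArg _ (ghost_ext fun j => by simp only [mul_entry, add_entry, add_mul])
  nsmul := nsmulRec
  npow := npowRec

/-- The preorder on Witt vectors induced by the difference preorder
`r ≤ r' ↔ ∃ c, r' = r + c` on the semiring of entries. -/
def Precedes (a b : PTypWitt p A) : Prop :=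
  ∀ f : PTypSymFun p, ∃ c : A, b.hom f = a.hom f + c

end PTypWitt

/-! ## The Boolean semiring -/

/-- The Boolean semiring `{0, 1}` with `1 + 1 = 1`. -/
inductive BoolSemiring : Type
  | zero : BoolSemiring
  | one : BoolSemiring

namespace BoolSemiring

instance : Zero BoolSemiring := ⟨zero⟩

instance : One BoolSemiring := ⟨one⟩

instance : Add BoolSemiring where
  add
    | zero, b => b
    | one, _ => one

instance : Mul BoolSemiring where
  mul
    | zero, _ => zero
    | one, b => b

instance : CommSemiring BoolSemiring where
  add_assoc a b c := by cases a <;> rfl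
  zero_add a := rfl
  add_zero a := by cases a <;> rfl
  add_comm a b := by cases a <;> cases b <;> rfl
  mul_assoc a b c := by cases a <;> rfl
  one_mul a := rfl
  mul_one a := by cases a <;> rfl
  mul_comm a b := by cases a <;> cases b <;> rfl
  zero_mul a := rfl
  mul_zero a := by cases a <;> rfl
  left_distrib a b c := by cases a <;> rfl
  right_distrib a b c := by cases a <;> cases b <;> cases c <;> rfl
  nsmul := nsmulRec
  npow := npowRec

end BoolSemiring

/-- The element `(x, y)` of `ℕ² ∪ {∞}`; the element `∞` is `⊤`, and the order is the componentwise
order of `ℕ²` with the greatest element `∞` added. -/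
def pt (x y : ℕ) : WithTop (ℕ × ℕ) := ((x, y) : ℕ × ℕ)

end

end BooleanWitt

namespace BooleanWitt

noncomputable section

open MvPolynomial
open scoped TensorProduct

/-! ## The Boolean semiring -/

namespace BoolSemiring

/-! The semiring `Λ_{ℕ,(p)}` is presented by the generators `d_{i,j}` and the relations `p d_{i+1,j}
+ d_{i,j+1} = d_{i,j} ^ p`, because these relations reduce every polynomial to monomials with
exponents below `p`, and such monomials are linearly independent over `ℕ` (`exists_entry_eq`). In
the Boolean semiring the factor `p` and the `p`-th power are invisible, so a Witt vector is exactly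
a set of zeros `(i, j)` with the rule: `(i, j)` is a zero if and only if `(i+1, j)` and `(i, j+1)`
both are. Such a set is empty or a quadrant, which gives the bijection; the order is reverse
inclusion of zero sets.

The operations are governed by three principles. Sums and products are monotone, so a result that
dominates `∞` is `∞`. The entries `a_{0,j}` are added and multiplied termwise, and they suffice to
recognise the elements `(0, y)`. The Frobenius map shifts the index `j` and respects sums, which
gives `(x,0) + (0,y) = (x,y)`.

The natural number `n` is computed in `W(ℕ)`: there its entries do not depend on `j`, and they
follow the recursion `k ↦ (k ^ p - k) / p` starting at `n`. This reaches `0` for `n ≤ 1`, and for `n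
= 2` if `p = 2` (through `2, 1, 0`); otherwise it never vanishes and `n = ∞`. Monotonicity then
yields the sums `(x,0) + (x',0)`, and for `p = 2` also the products, from `2 + 2 = 2 · 2 = 4 = ∞`.

For `p > 2` the product `(x,0)(x',0)` needs another argument, since `2` is already `∞`. By induction
the coproduct of each `d_{i,j}` with `i ≥ 1` is a sum `v + w` of two parts that are both nonzero at
the given pair of Witt vectors: the mixed terms `v w^{p-1}` and `v^{p-1} w` of `(v + w) ^ p` survive
the division by `p` and are separate summands (`exists_comul_dGen_eq_add`).

Finally `(x,y) = (x,0) + (0,y)` and distributivity reduce every sum and product to cases whose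
answers do not depend on `p > 2`. -/

theorem eq_zero_or_one (b : BoolSemiring) : b = 0 ∨ b = 1 := by
  cases b
  exacts [Or.inl rfl, Or.inr rfl]

instance : Nontrivial BoolSemiring := ⟨0, 1, fun h => nomatch h⟩

instance : NoZeroDivisors BoolSemiring where
  eq_zero_or_eq_zero_of_mul_eq_zero {a b} h := by
    rcases eq_zero_or_one a with rfl | rfl
    · exact Or.inl rfl
    · exact Or.inr h

theorem ne_zero_iff {b : BoolSemiring} : b ≠ 0 ↔ b = 1 := by
  rcases eq_zero_or_one b with rfl | rfl <;> simp

theorem one_add (b : BoolSemiring) : 1 + b = 1 := rfl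

theorem add_eq_zero {a b : BoolSemiring} : a + b = 0 ↔ a = 0 ∧ b = 0 := by
  rcases eq_zero_or_one a with rfl | rfl
  · simp
  · simp [one_add]

theorem natCast_eq_zero {n : ℕ} : (n : BoolSemiring) = 0 ↔ n = 0 := by
  cases n with
  | zero => simp
  | succ n => rw [Nat.cast_succ, add_comm, one_add]; simp

theorem ext_zero {a b : BoolSemiring} (h : a = 0 ↔ b = 0) : a = b := by
  rcases eq_zero_or_one a with rfl | rfl
  · exact (h.1 rfl).symm
  · exact (ne_zero_iff.1 fun hb => one_ne_zero (h.2 hb)).symm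

/-- The difference preorder on the Boolean semiring is just `0 ≤ 1`; this turns `Precedes` into an
inclusion of zero sets. -/
theorem exists_eq_add {a b : BoolSemiring} : (∃ c, b = a + c) ↔ (b = 0 → a = 0) := by
  constructor
  · rintro ⟨c, rfl⟩ h
    exact (add_eq_zero.1 h).1
  · intro h
    rcases eq_zero_or_one a with rfl | rfl
    · exact ⟨b, (zero_add b).symm⟩
    · exact ⟨0, ne_zero_iff.1 fun hb => one_ne_zero (h hb)⟩

end BoolSemiring

/-! ## Generators and relations -/

section Presentation

variable (p : ℕ) [hp : Fact p.Prime]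

/-- In a semiring with elements `g (i, j)` satisfying the relations of the `d_{i,j}`, all
polynomials in these elements are combinations of reduced monomials. -/
theorem natEval_mem_span_redMono {R : Type*} [CommSemiring R] (g : ℕ × ℕ → R)
    (hg : ∀ i j, (p : R) * g (i + 1, j) + g (i, j + 1) = g (i, j) ^ p)
    (q : MvPolynomial (ℕ × ℕ) ℕ) :
    natEval g q ∈ Submodule.span ℕ (Set.range fun e : RedExp p => monoProd g e.1) := by
  classical
  -- Induction on the total degree: trading a factor `g (i, j) ^ p` for `p g (i+1, j) + g (i, j+1)`
  -- lowers the degree by `p - 1 > 0`.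
  have key : ∀ (n : ℕ) (e : ℕ × ℕ →₀ ℕ), e.degree = n →
      monoProd g e ∈ Submodule.span ℕ (Set.range fun e : RedExp p => monoProd g e.1) := by
    intro n
    induction n using Nat.strong_induction_on with
    | _ n ih =>
    intro e he
    by_cases hred : ∀ k, e k < p
    · exact Submodule.subset_span ⟨⟨e, hred⟩, rfl⟩
    push Not at hred
    obtain ⟨⟨i, j⟩, hk⟩ := hred
    obtain ⟨e', rfl⟩ : ∃ e', e = e' + Finsupp.single (i, j) p :=
      ⟨e - Finsupp.single (i, j) p, (tsub_add_cancel_of_le (Finsupp.single_le_iff.2 hk)).symm⟩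
    have hmul : ∀ (k : ℕ × ℕ) (m : ℕ), monoProd g (e' + Finsupp.single k m) =
        monoProd g e' * g k ^ m := by
      intro k m
      rw [monoProd, Finsupp.prod_add_index' (by simp) (by simp [pow_add]),
        Finsupp.prod_single_index (by simp)]
      rfl
    have hlt : ∀ k : ℕ × ℕ, (e' + Finsupp.single k 1).degree < n := by
      intro k
      rw [← he, map_add, map_add, Finsupp.degree_single, Finsupp.degree_single]
      exact Nat.add_lt_add_left hp.out.one_lt _
    have h1 := ih _ (hlt (i + 1, j)) _ rfl
    have h2 := ih _ (hlt (i, j + 1)) _ rfl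
    rw [hmul, pow_one] at h1 h2
    rw [hmul, ← hg, mul_add, mul_left_comm, ← nsmul_eq_mul]
    exact add_mem (nsmul_mem h1 p) h2
  induction q using natPoly_induction with
  | h0 => rw [map_zero]; exact zero_mem _
  | hadd q r hq hr => rw [map_add]; exact add_mem hq hr
  | hm α =>
    have := key _ α rfl
    rwa [coe_eval₂Hom, eval₂_monomial, map_one, one_mul]

/-- The semiring of `p`-typical symmetric functions is presented by the generators `d_{i,j}` and
the relations `p d_{i+1,j} + d_{i,j+1} = d_{i,j} ^ p`. -/
theorem exists_entry_eq {A : Type*} [CommSemiring A] (x : ℕ → ℕ → A)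
    (hx : ∀ i j, (p : A) * x (i + 1) j + x i (j + 1) = x i j ^ p) :
    ∃ a : PTypWitt p A, ∀ i j, a.entry i j = x i j := by
  -- The homomorphism is built from its graph: the subsemiring of `Λ_{ℕ,(p)} × A` generated by the
  -- pairs `(d_{i,j}, x i j)`, once its first projection is known to be bijective.
  let g : ℕ × ℕ → PTypSymFun p × A := fun k => (dGen p k.1 k.2, x k.1 k.2)
  have hg : ∀ i j, (p : PTypSymFun p × A) * g (i + 1, j) + g (i, j + 1) = g (i, j) ^ p :=
    fun i j => Prod.ext (dGen_rel p i j) (hx i j)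
  let S := RingHom.rangeS (natEval g)
  have hgS : ∀ k, g k ∈ S := fun k => ⟨X k, by simp⟩
  let π : S →+* PTypSymFun p := (RingHom.fst _ _).comp S.subtype
  have hπ : Function.Bijective π := by
    constructor
    · have hspan : ∀ u : S, ∃ c : RedExp p →₀ ℕ,
          Finsupp.linearCombination ℕ (fun e : RedExp p => monoProd g e.1) c = u.1 := by
        rintro ⟨_, q, rfl⟩
        exact (Finsupp.mem_span_range_iff_exists_finsupp.1 (natEval_mem_span_redMono p g hg q))
      intro u v huv
      obtain ⟨c, hc⟩ := hspan u
      obtain ⟨c', hc'⟩ := hspan v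
      have hfst : ∀ c : RedExp p →₀ ℕ,
          (Finsupp.linearCombination ℕ (fun e : RedExp p => monoProd g e.1) c).1 =
          Finsupp.linearCombination ℕ
            (fun e : RedExp p => monoProd (fun k => dGen p k.1 k.2) e.1) c := by
        intro c
        change (LinearMap.fst ℕ (PTypSymFun p) A) _ = _
        rw [Finsupp.apply_linearCombination]
        congr 2
        funext e
        exact map_monoProd (RingHom.fst _ _) g e.1
      -- The pairs satisfy the relations, so both elements are combinations of reduced monomials;
      -- the first components already determine the coefficients, by linear independence.
      have hcc : c = c' := by
        refine redMono_linearIndependent p ?_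
        rw [← hfst, ← hfst, hc, hc']
        exact huv
      exact Subtype.ext (by rw [← hc, ← hc', hcc])
    · exact mem_of_dGen_mem (RingHom.rangeS π) fun i j => ⟨⟨g (i, j), hgS _⟩, rfl⟩
  let e : S ≃+* PTypSymFun p := RingEquiv.ofBijective π hπ
  refine ⟨PTypWitt.mk (((RingHom.snd _ _).comp S.subtype).comp e.symm.toRingHom), fun i j => ?_⟩
  have he : e.symm (dGen p i j) = ⟨g (i, j), hgS _⟩ := by
    rw [RingEquiv.symm_apply_eq]
    rfl
  change (e.symm (dGen p i j)).1.2 = _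
  rw [he]

end Presentation

/-! ## Monotonicity and the Frobenius map -/

namespace PTypWitt

variable {p : ℕ} [hp : Fact p.Prime]

section General

variable {A : Type*} [CommSemiring A]

theorem entry_rel (a : PTypWitt p A) (i j : ℕ) :
    (p : A) * a.entry (i + 1) j + a.entry i (j + 1) = a.entry i j ^ p := by
  have := congrArg a.hom (dGen_rel p i j)
  rwa [_root_.map_add, _root_.map_mul, map_pow, map_natCast] at this

theorem entry_ext {a b : PTypWitt p A} (h : ∀ i j, a.entry i j = b.entry i j) : a = b :=
  hom_ext (RingHom.ext (mem_of_dGen_mem (RingHom.eqLocusS a.hom b.hom) h))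

/-- The elements `f` at which the comparison holds form a subsemiring, so it is enough to compare on
generators. -/
theorem precedes_of_entry {a b : PTypWitt p A}
    (h : ∀ i j, ∃ c, b.entry i j = a.entry i j + c) : a.Precedes b := by
  let S : Subsemiring (PTypSymFun p) :=
    { carrier := {f | ∃ c, b.hom f = a.hom f + c}
      zero_mem' := ⟨0, by simp⟩
      one_mem' := ⟨0, by simp⟩
      add_mem' := by
        rintro f g ⟨c, hc⟩ ⟨c', hc'⟩
        exact ⟨c + c', by rw [_root_.map_add, _root_.map_add, hc, hc']; ring⟩
      mul_mem' := by
        rintro f g ⟨c, hc⟩ ⟨c', hc'⟩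
        exact ⟨a.hom f * c' + c * a.hom g + c * c', by
          rw [_root_.map_mul, _root_.map_mul, hc, hc']; ring⟩ }
  exact mem_of_dGen_mem S h

/-- Elements of the tensor square are sums of pure tensors, without subtraction, so evaluation is
monotone in both Witt vectors. This is the source of monotonicity for both operations, whatever the
coproducts are. -/
theorem pair_precedes {a a' b b' : PTypWitt p A} (ha : a.Precedes a') (hb : b.Precedes b')
    (u : PTypSymFun p ⊗[ℕ] PTypSymFun p) : ∃ c, pair a'.hom b'.hom u = pair a.hom b.hom u + c := by
  induction u using TensorProduct.induction_on with
  | zero => exact ⟨0, by simp⟩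
  | tmul x y =>
    obtain ⟨c, hc⟩ := ha x
    obtain ⟨c', hc'⟩ := hb y
    refine ⟨a.hom x * c' + c * b.hom y + c * c', ?_⟩
    rw [pair_tmul, pair_tmul, hc, hc']
    ring
  | add x y hx hy =>
    obtain ⟨c, hc⟩ := hx
    obtain ⟨c', hc'⟩ := hy
    exact ⟨c + c', by rw [_root_.map_add, _root_.map_add, hc, hc']; ring⟩

theorem Precedes.add {a a' b b' : PTypWitt p A} (ha : a.Precedes a') (hb : b.Precedes b') :
    (a + b).Precedes (a' + b') := fun _ => pair_precedes ha hb _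

theorem Precedes.mul {a a' b b' : PTypWitt p A} (ha : a.Precedes a') (hb : b.Precedes b') :
    (a * b).Precedes (a' * b') := fun _ => pair_precedes ha hb _

theorem Precedes.refl (a : PTypWitt p A) : a.Precedes a := fun _ => ⟨0, (add_zero _).symm⟩

/-- The Frobenius map, induced by `ψ ∘ ·`. -/
def frob (a : PTypWitt p A) : PTypWitt p A := mk (a.hom.comp (adamsP p))

theorem frob_entry (a : PTypWitt p A) (i j : ℕ) : a.frob.entry i j = a.entry i (j + 1) :=
  congrArg a.hom (adamsP_dGen p i j)

/-- The tensor square is additively free. Hence homomorphisms into it can be compared on the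
`d_{0,j}` alone, and identities in it can be divided by `p`. -/
theorem pCancel_tensor : PCancel p (PTypSymFun p ⊗[ℕ] PTypSymFun p) :=
  ((freeNat_pTypSymFun p).tensor (freeNat_pTypSymFun p)).pCancel hp.out.ne_zero

/-- On `d_{0,j}` both sides give `d_{0,j+1} ⊗ 1 + 1 ⊗ d_{0,j+1}`, and cancellation propagates this
to all `f`. It makes the Frobenius map additive. -/
theorem coadd_adamsP (f : PTypSymFun p) : coadd p (adamsP p f) = adamsT p (coadd p f) := by
  refine DFunLike.congr_fun (hom_ext_ghost pCancel_tensor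
    (a := (coadd p).comp (adamsP p)) (b := (adamsT p).comp (coadd p)) fun j => ?_) f
  rw [RingHom.comp_apply, RingHom.comp_apply, adamsP_dGen, coadd_dGen_zero, coadd_dGen_zero,
    _root_.map_add, adamsT_tmul, adamsT_tmul, adamsP_dGen, map_one]

theorem comul_adamsP (f : PTypSymFun p) : comul p (adamsP p f) = adamsT p (comul p f) := by
  refine DFunLike.congr_fun (hom_ext_ghost pCancel_tensor
    (a := (comul p).comp (adamsP p)) (b := (adamsT p).comp (comul p)) fun j => ?_) f
  rw [RingHom.comp_apply, RingHom.comp_apply, adamsP_dGen, comul_dGen_zero, comul_dGen_zero,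
    adamsT_tmul, adamsP_dGen]

theorem pair_frob (a b : PTypWitt p A) (u : PTypSymFun p ⊗[ℕ] PTypSymFun p) :
    pair a.frob.hom b.frob.hom u = pair a.hom b.hom (adamsT p u) := by
  refine DFunLike.congr_fun (tensorHom_ext (f := pair a.frob.hom b.frob.hom)
    (g := (pair a.hom b.hom).comp (adamsT p)) fun x y => ?_) u
  rw [RingHom.comp_apply, adamsT_tmul, pair_tmul, pair_tmul]
  rfl

theorem frob_add (a b : PTypWitt p A) : (a + b).frob = a.frob + b.frob :=
  hom_ext (RingHom.ext fun f => (congrArg (pair a.hom b.hom) (coadd_adamsP f)).trans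
    (pair_frob a b _).symm)

theorem iterate_frob_add (n : ℕ) (a b : PTypWitt p A) :
    frob^[n] (a + b) = frob^[n] a + frob^[n] b := by
  induction n generalizing a b with
  | zero => rfl
  | succ n ih => rw [Function.iterate_succ_apply, frob_add, ih]; rfl

theorem iterate_frob_entry (n : ℕ) (a : PTypWitt p A) (i j : ℕ) :
    (frob^[n] a).entry i j = a.entry i (j + n) := by
  induction n generalizing a with
  | zero => rfl
  | succ n ih => rw [Function.iterate_succ_apply, ih, frob_entry, add_assoc]

/-- Natural numbers in any `W(B)` come from `W(ℕ)`, where their entries are honest integers that can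
be computed. -/
theorem map_natCast' {B : Type*} [CommSemiring B] (h : A →+* B) (n : ℕ) :
    map h (n : PTypWitt p A) = n := by
  induction n with
  | zero => rw [Nat.cast_zero, Nat.cast_zero, map_zero']
  | succ n ih => rw [Nat.cast_succ, Nat.cast_succ, map_add', ih, map_one']

theorem natCast_entry_zero (n j : ℕ) : (n : PTypWitt p A).entry 0 j = n := by
  induction n with
  | zero => rw [Nat.cast_zero, Nat.cast_zero, zero_entry]
  | succ n ih => rw [Nat.cast_succ, Nat.cast_succ, add_entry, ih, one_entry]

end General

end PTypWitt

/-! ## Coordinates on the Boolean Witt vectors -/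

theorem pt_le_pt {x y i j : ℕ} : pt x y ≤ pt i j ↔ x ≤ i ∧ y ≤ j := by
  rw [pt, pt, WithTop.coe_le_coe, Prod.mk_le_mk]

theorem not_top_le_pt (i j : ℕ) : ¬ (⊤ : WithTop (ℕ × ℕ)) ≤ pt i j := WithTop.not_top_le_coe _

theorem eq_top_or_eq_pt (z : WithTop (ℕ × ℕ)) : z = ⊤ ∨ ∃ x y, z = pt x y := by
  induction z with
  | top => exact Or.inl rfl
  | coe a => exact Or.inr ⟨a.1, a.2, rfl⟩

/-- An element is determined by its finite upper bounds, of which `∞` has none; these bounds are the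
zero set of the corresponding Witt vector. -/
theorem le_iff_forall_le_pt {z w : WithTop (ℕ × ℕ)} :
    z ≤ w ↔ ∀ i j, w ≤ pt i j → z ≤ pt i j := by
  refine ⟨fun h i j hw => h.trans hw, fun h => ?_⟩
  rcases eq_top_or_eq_pt w with rfl | ⟨x, y, rfl⟩
  · exact le_top
  · exact h x y le_rfl

/-- The infimum of `(i+1, j)` and `(i, j+1)` is `(i, j)`; so every quadrant, and the empty set,
obeys the rule for zero sets. -/
theorem le_pt_iff_succ (z : WithTop (ℕ × ℕ)) (i j : ℕ) :
    z ≤ pt (i + 1) j ∧ z ≤ pt i (j + 1) ↔ z ≤ pt i j := by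
  rcases eq_top_or_eq_pt z with rfl | ⟨x, y, rfl⟩
  · simp only [not_top_le_pt, and_self]
  · simp only [pt_le_pt]; omega

namespace PTypWitt

variable {p : ℕ} [hp : Fact p.Prime]

section Zeros

variable (a : PTypWitt p BoolSemiring)

/-- The defining relation read in a semiring without zero divisors, where a sum vanishes only if
both terms do and where `p` is nonzero. -/
theorem entry_eq_zero_iff (i j : ℕ) :
    a.entry i j = 0 ↔ a.entry (i + 1) j = 0 ∧ a.entry i (j + 1) = 0 := by
  rw [← pow_eq_zero_iff (M₀ := BoolSemiring) hp.out.ne_zero, ← entry_rel,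
    BoolSemiring.add_eq_zero, mul_eq_zero, BoolSemiring.natCast_eq_zero]
  simp [hp.out.ne_zero]

variable {a}

theorem entry_add_eq_zero {i j : ℕ} (h : a.entry i j = 0) (k l : ℕ) :
    a.entry (i + k) (j + l) = 0 := by
  have h1 : a.entry (i + k) j = 0 := by
    induction k with
    | zero => exact h
    | succ k ih => exact ((entry_eq_zero_iff a _ _).1 ih).1
  induction l with
  | zero => exact h1
  | succ l ih => exact ((entry_eq_zero_iff a _ _).1 ih).2

/-- Zeros to the right and above force a zero at the corner: the hypotheses pass to `(i+1, j)` and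
`(i, j+1)`, at smaller distance, and the rule for zero sets returns to `(i, j)`. Hence the zero set
is closed under componentwise minimum. -/
theorem entry_eq_zero_of_add (k l : ℕ) {i j : ℕ} (h : a.entry (i + k) j = 0)
    (h' : a.entry i (j + l) = 0) : a.entry i j = 0 := by
  induction k generalizing i j l with
  | zero => exact h
  | succ k ihk =>
    induction l generalizing j with
    | zero => exact h'
    | succ l ihl =>
      refine (entry_eq_zero_iff a i j).2 ⟨?_, ?_⟩
      · exact ihk (l + 1) (by rwa [add_assoc, add_comm 1]) (entry_add_eq_zero h' 1 0)
      · exact ihl (entry_add_eq_zero h 0 1) (by rwa [add_assoc, add_comm 1])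

variable (a)

/-- The zero set of a Boolean Witt vector is empty or a quadrant. -/
theorem exists_coord : ∃ z : WithTop (ℕ × ℕ), ∀ i j, a.entry i j = 0 ↔ z ≤ pt i j := by
  classical
  by_cases h : ∃ i j, a.entry i j = 0
  · have h' : ∃ j i, a.entry i j = 0 := let ⟨i, j, hij⟩ := h; ⟨j, i, hij⟩
    -- The least first and the least second coordinate may be attained at two different zeros; the
    -- corner they span is again a zero.
    have hxy : a.entry (Nat.find h) (Nat.find h') = 0 := by
      obtain ⟨j, hj⟩ := Nat.find_spec h
      obtain ⟨i, hi⟩ := Nat.find_spec h'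
      obtain ⟨k, hk⟩ := Nat.exists_eq_add_of_le (Nat.find_min' h ⟨_, hi⟩)
      obtain ⟨l, hl⟩ := Nat.exists_eq_add_of_le (Nat.find_min' h' ⟨_, hj⟩)
      exact entry_eq_zero_of_add k l (by rwa [← hk]) (by rwa [← hl])
    refine ⟨pt (Nat.find h) (Nat.find h'), fun i j => ⟨fun hij => ?_, fun hij => ?_⟩⟩
    · exact pt_le_pt.2 ⟨Nat.find_min' h ⟨j, hij⟩, Nat.find_min' h' ⟨i, hij⟩⟩
    · obtain ⟨hi, hj⟩ := pt_le_pt.1 hij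
      obtain ⟨k, rfl⟩ := Nat.exists_eq_add_of_le hi
      obtain ⟨l, rfl⟩ := Nat.exists_eq_add_of_le hj
      exact entry_add_eq_zero hxy k l
  · push Not at h
    exact ⟨⊤, fun i j => iff_of_false (h i j) (not_top_le_pt i j)⟩

end Zeros

-- By the presentation, a Boolean Witt vector with prescribed zeros exists as soon as the indicator
-- function of the nonzero entries satisfies the relations.
variable (p) in
theorem exists_entry_eq_zero_iff (z : WithTop (ℕ × ℕ)) :
    ∃ a : PTypWitt p BoolSemiring, ∀ i j, a.entry i j = 0 ↔ z ≤ pt i j := by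
  classical
  let x : ℕ → ℕ → BoolSemiring := fun i j => if z ≤ pt i j then 0 else 1
  have hx0 : ∀ i j, x i j = 0 ↔ z ≤ pt i j := fun i j => by simp [x]
  obtain ⟨a, ha⟩ := exists_entry_eq p x fun i j => BoolSemiring.ext_zero (by
    rw [pow_eq_zero_iff (M₀ := BoolSemiring) hp.out.ne_zero, BoolSemiring.add_eq_zero,
      mul_eq_zero, BoolSemiring.natCast_eq_zero, hx0, hx0, hx0, or_iff_right hp.out.ne_zero]
    exact le_pt_iff_succ z i j)
  exact ⟨a, fun i j => by rw [ha, hx0]⟩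

/-! ### The order on Boolean Witt vectors and the bijection with `ℕ² ∪ {∞}`. -/

theorem precedes_iff {a b : PTypWitt p BoolSemiring} :
    a.Precedes b ↔ ∀ i j, b.entry i j = 0 → a.entry i j = 0 :=
  ⟨fun h _ _ => BoolSemiring.exists_eq_add.1 (h _),
    fun h => precedes_of_entry fun i j => BoolSemiring.exists_eq_add.2 (h i j)⟩

theorem Precedes.antisymm {a b : PTypWitt p BoolSemiring} (h : a.Precedes b)
    (h' : b.Precedes a) : a = b :=
  entry_ext fun i j => BoolSemiring.ext_zero ⟨precedes_iff.1 h' i j, precedes_iff.1 h i j⟩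

variable (p) in
/-- The bijection between `ℕ² ∪ {∞}` and the Boolean Witt vectors. -/
def coordEquiv : WithTop (ℕ × ℕ) ≃ PTypWitt p BoolSemiring :=
  Equiv.ofBijective (fun z => (exists_entry_eq_zero_iff p z).choose) (by
    have spec := fun z => (exists_entry_eq_zero_iff p z).choose_spec
    refine ⟨fun z w h => ?_, fun a => ?_⟩
    · have hzw : ∀ i j, z ≤ pt i j ↔ w ≤ pt i j := fun i j => by
        rw [← spec z, ← spec w]
        exact iff_of_eq (congrArg (fun a => PTypWitt.entry a i j = 0) h)
      exact le_antisymm (le_iff_forall_le_pt.2 fun i j => (hzw i j).2)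
        (le_iff_forall_le_pt.2 fun i j => (hzw i j).1)
    · obtain ⟨z, hz⟩ := exists_coord a
      exact ⟨z, entry_ext fun i j => BoolSemiring.ext_zero ((spec z i j).trans (hz i j).symm)⟩)

theorem coordEquiv_entry {z : WithTop (ℕ × ℕ)} {i j : ℕ} :
    (coordEquiv p z).entry i j = 0 ↔ z ≤ pt i j :=
  (exists_entry_eq_zero_iff p z).choose_spec i j

theorem coordEquiv_pt_entry {x y i j : ℕ} :
    (coordEquiv p (pt x y)).entry i j = 0 ↔ x ≤ i ∧ y ≤ j :=
  coordEquiv_entry.trans pt_le_pt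

theorem coordEquiv_top_entry (i j : ℕ) : (coordEquiv p ⊤).entry i j = 1 :=
  BoolSemiring.ne_zero_iff.1 fun h => not_top_le_pt i j (coordEquiv_entry.1 h)

theorem coordEquiv_precedes {z w : WithTop (ℕ × ℕ)} :
    (coordEquiv p z).Precedes (coordEquiv p w) ↔ z ≤ w := by
  simp only [precedes_iff, coordEquiv_entry]
  exact le_iff_forall_le_pt.symm

theorem eq_coordEquiv {a : PTypWitt p BoolSemiring} {z : WithTop (ℕ × ℕ)}
    (h : ∀ i j, a.entry i j = 0 ↔ z ≤ pt i j) : a = coordEquiv p z :=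
  entry_ext fun i j => BoolSemiring.ext_zero ((h i j).trans coordEquiv_entry.symm)

/-- The way in which sums and products are shown to be `∞`: it suffices to bound them below by
something known to be `∞`. -/
theorem eq_top_of_precedes {a : PTypWitt p BoolSemiring} (h : (coordEquiv p ⊤).Precedes a) :
    a = coordEquiv p ⊤ := by
  obtain ⟨z, rfl⟩ := (coordEquiv p).surjective a
  rw [top_le_iff.1 (coordEquiv_precedes.1 h)]

/-- A Witt vector `(0, y)` is determined by its entries `a_{0,j}`. -/
theorem eq_coordEquiv_zero {a : PTypWitt p BoolSemiring} {y : ℕ}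
    (h : ∀ j, a.entry 0 j = 0 ↔ y ≤ j) : a = coordEquiv p (pt 0 y) := by
  obtain ⟨z, rfl⟩ := (coordEquiv p).surjective a
  simp only [coordEquiv_entry] at h
  rcases eq_top_or_eq_pt z with rfl | ⟨u, v, rfl⟩
  · exact absurd ((h y).2 le_rfl) (not_top_le_pt _ _)
  · simp only [pt_le_pt] at h
    have h1 := (h y).2 le_rfl
    have h2 := (h v).1 ⟨h1.1, le_rfl⟩
    rw [Nat.le_zero.1 h1.1, le_antisymm h1.2 h2]

theorem zero_eq : (0 : PTypWitt p BoolSemiring) = coordEquiv p (pt 0 0) :=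
  eq_coordEquiv_zero fun j => by simp [zero_entry]

theorem zero_precedes (a : PTypWitt p BoolSemiring) : (0 : PTypWitt p BoolSemiring).Precedes a := by
  obtain ⟨z, rfl⟩ := (coordEquiv p).surjective a
  rw [zero_eq, coordEquiv_precedes]
  exact le_iff_forall_le_pt.2 fun i j _ => pt_le_pt.2 ⟨zero_le, zero_le⟩

theorem precedes_add_right (a b : PTypWitt p BoolSemiring) : a.Precedes (a + b) := by
  simpa only [add_zero] using (Precedes.refl a).add (zero_precedes b)

theorem precedes_add_left (a b : PTypWitt p BoolSemiring) : b.Precedes (a + b) := by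
  rw [add_comm]
  exact precedes_add_right b a

theorem top_add (a : PTypWitt p BoolSemiring) : coordEquiv p ⊤ + a = coordEquiv p ⊤ :=
  eq_top_of_precedes (precedes_add_right _ _)

/-! ### Natural numbers -/

/-- Over `ℕ` this is a recursion in `i` that determines all entries of `n` from the constant row
`a_{0,j} = n`. -/
theorem natCast_entry_nat (n i j : ℕ) :
    p * (n : PTypWitt p ℕ).entry (i + 1) j + (n : PTypWitt p ℕ).entry i (j + 1) =
      (n : PTypWitt p ℕ).entry i j ^ p := entry_rel _ i j

theorem natCast_entry_eq_zero {n i j : ℕ} :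
    (n : PTypWitt p BoolSemiring).entry i j = 0 ↔ (n : PTypWitt p ℕ).entry i j = 0 := by
  rw [← map_natCast' (Nat.castRingHom BoolSemiring)]
  exact BoolSemiring.natCast_eq_zero

theorem one_eq : (1 : PTypWitt p BoolSemiring) = coordEquiv p (pt 1 0) := by
  have h0 : ∀ j, ((1 : ℕ) : PTypWitt p ℕ).entry 0 j = 1 := fun j => natCast_entry_zero 1 j
  have h1 : ∀ j, ((1 : ℕ) : PTypWitt p ℕ).entry 1 j = 0 := fun j => by
    have := natCast_entry_nat (p := p) 1 0 j
    rw [h0, h0, one_pow] at this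
    simpa [hp.out.ne_zero] using this
  refine eq_coordEquiv fun i j => ?_
  rw [← Nat.cast_one (R := PTypWitt p BoolSemiring), pt_le_pt]
  cases i with
  | zero => rw [natCast_entry_eq_zero, h0]; omega
  | succ i =>
    refine iff_of_true ?_ ⟨by omega, zero_le⟩
    have := entry_add_eq_zero (natCast_entry_eq_zero.2 (h1 0)) i j
    rwa [add_comm 1, Nat.zero_add] at this

/-- For `p = 2` the recursion `k ↦ k (k - 1) / 2` runs through `2, 1, 0`. -/
theorem two_eq [h2 : Fact (Nat.Prime 2)] :
    ((2 : ℕ) : PTypWitt 2 BoolSemiring) = coordEquiv 2 (pt 2 0) := by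
  have h0 : ∀ j, ((2 : ℕ) : PTypWitt 2 ℕ).entry 0 j = 2 := fun j => natCast_entry_zero 2 j
  have h1 : ∀ j, ((2 : ℕ) : PTypWitt 2 ℕ).entry 1 j = 1 := fun j => by
    have := natCast_entry_nat (p := 2) 2 0 j
    rw [h0, h0, Nat.zero_add] at this
    omega
  have h2 : ∀ j, ((2 : ℕ) : PTypWitt 2 ℕ).entry 2 j = 0 := fun j => by
    have := natCast_entry_nat (p := 2) 2 1 j
    rw [h1, h1, one_add_one_eq_two] at this
    omega
  refine eq_coordEquiv fun i j => ?_
  rw [pt_le_pt]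
  match i with
  | 0 => rw [natCast_entry_eq_zero, h0]; omega
  | 1 => rw [natCast_entry_eq_zero, h1]; omega
  | i + 2 =>
    refine iff_of_true ?_ ⟨by omega, zero_le⟩
    have := entry_add_eq_zero (natCast_entry_eq_zero.2 (h2 0)) i j
    rwa [add_comm 2, Nat.zero_add] at this

/-- If the recursion `k ↦ (k ^ p - k) / p` never leaves the range `k ≥ m > 0`, no entry of `n`
vanishes. -/
theorem natCast_eq_top_of_step {n : ℕ} (m : ℕ) (hm : m ≠ 0) (hmn : m ≤ n)
    (step : ∀ k l : ℕ, m ≤ k → p * l + k = k ^ p → m ≤ l) :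
    (n : PTypWitt p BoolSemiring) = coordEquiv p ⊤ := by
  have key : ∀ i, ∃ k, m ≤ k ∧ ∀ j, (n : PTypWitt p ℕ).entry i j = k := by
    intro i
    induction i with
    | zero => exact ⟨n, hmn, fun j => natCast_entry_zero n j⟩
    | succ i ih =>
      obtain ⟨k, hk, hij⟩ := ih
      have h := fun j => natCast_entry_nat (p := p) n i j
      simp only [hij] at h
      refine ⟨(n : PTypWitt p ℕ).entry (i + 1) 0, step k _ hk (h 0), fun j => ?_⟩
      exact Nat.eq_of_mul_eq_mul_left hp.out.pos (Nat.add_right_cancel ((h j).trans (h 0).symm))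
  refine eq_coordEquiv fun i j => iff_of_false (fun h => ?_) (not_top_le_pt i j)
  obtain ⟨k, hk, hij⟩ := key i
  rw [natCast_entry_eq_zero, hij] at h
  omega

theorem natCast_eq_top_of_two_lt (h : 2 < p) {n : ℕ} (hn : 2 ≤ n) :
    (n : PTypWitt p BoolSemiring) = coordEquiv p ⊤ := by
  refine natCast_eq_top_of_step 2 two_ne_zero hn fun k l hk hl => ?_
  -- From `k ^ (p-2) ≥ 2 ^ (p-2) ≥ p - 1` follows `k ^ p ≥ (p - 1) k² ≥ 2 (p - 1) k`, which exceeds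
  -- `p + k` for `k ≥ 2`; so `l ≤ 1` is impossible.
  obtain ⟨q, rfl⟩ : ∃ q, p = q + 3 := ⟨p - 3, by omega⟩
  by_contra hlt
  have h1 : q + 1 < 2 ^ (q + 1) := Nat.lt_two_pow_self
  have h2 : 2 ^ (q + 1) ≤ k ^ (q + 1) := Nat.pow_le_pow_left hk _
  have h3 : k ^ (q + 3) = k ^ (q + 1) * (k * k) := by ring
  have h4 : 2 * k ≤ k * k := Nat.mul_le_mul_right k hk
  have h5 : (q + 2) * (k * k) ≤ k ^ (q + 1) * (k * k) := Nat.mul_le_mul_right _ (by omega)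
  have h6 : (q + 3) * l ≤ (q + 3) * 1 := Nat.mul_le_mul_left _ (by omega)
  nlinarith

theorem natCast_eq_top_of_eq_two [Fact (Nat.Prime 2)] {n : ℕ} (hn : 3 ≤ n) :
    (n : PTypWitt 2 BoolSemiring) = coordEquiv 2 ⊤ := by
  refine natCast_eq_top_of_step 3 three_ne_zero hn fun k l hk hl => ?_
  -- Here `2 l = k (k - 1) ≥ 6`; the bound `3` is a fixed point of the recursion.
  nlinarith

theorem eq_two_of_not_two_lt (h : ¬ 2 < p) : p = 2 :=
  le_antisymm (not_lt.1 h) hp.out.two_le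

theorem natCast_eq_pt {n : ℕ} (hn : n ≤ 1 ∨ (p = 2 ∧ n ≤ 2)) :
    (n : PTypWitt p BoolSemiring) = coordEquiv p (pt n 0) := by
  by_cases h2 : n = 2
  · obtain ⟨rfl, -⟩ : p = 2 ∧ n ≤ 2 := hn.resolve_left (by omega)
    rw [h2]
    exact two_eq
  · obtain rfl | rfl : n = 0 ∨ n = 1 := by omega
    · rw [Nat.cast_zero, zero_eq]
    · rw [Nat.cast_one, one_eq]

theorem natCast_eq_top {n : ℕ} (hn : ¬(n ≤ 1 ∨ (p = 2 ∧ n ≤ 2))) :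
    (n : PTypWitt p BoolSemiring) = coordEquiv p ⊤ := by
  by_cases h : 2 < p
  · exact natCast_eq_top_of_two_lt h (by omega)
  · obtain rfl := eq_two_of_not_two_lt h
    exact natCast_eq_top_of_eq_two (by omega)

theorem pt_precedes {x y x' y' : ℕ} (hx : x ≤ x') (hy : y ≤ y') :
    (coordEquiv p (pt x y)).Precedes (coordEquiv p (pt x' y')) :=
  coordEquiv_precedes.2 (pt_le_pt.2 ⟨hx, hy⟩)

/-! ### Sums -/

/-- The sum dominates `1 + 1 = 2`, which is `∞` for `p > 2`. The weak bounds `1 ≤ x, x'` leave only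
sums with `0`, as the independence of `p` requires. -/
theorem pt_add_pt_of_two_lt (h : 2 < p) {x x' : ℕ} (hx : 1 ≤ x) (hx' : 1 ≤ x') :
    coordEquiv p (pt x 0) + coordEquiv p (pt x' 0) = coordEquiv p ⊤ := by
  refine eq_top_of_precedes ?_
  rw [← natCast_eq_top_of_two_lt h le_rfl, Nat.cast_two, ← one_add_one_eq_two, one_eq]
  exact (pt_precedes hx le_rfl).add (pt_precedes hx' le_rfl)

theorem pt_add_pt_eq_top {x x' : ℕ} (hx : 2 ≤ x) (hx' : 2 ≤ x') :
    coordEquiv p (pt x 0) + coordEquiv p (pt x' 0) = coordEquiv p ⊤ := by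
  by_cases h : 2 < p
  · exact pt_add_pt_of_two_lt h (by omega) (by omega)
  · obtain rfl := eq_two_of_not_two_lt h
    refine eq_top_of_precedes ?_
    -- For `p = 2` the sum `1 + 1` is still finite, but both summands dominate `2 = (2, 0)`, and `4
    -- = ∞`.
    have h4 : ((2 + 2 : ℕ) : PTypWitt 2 BoolSemiring) = coordEquiv 2 ⊤ :=
      natCast_eq_top_of_eq_two (by norm_num)
    rw [← h4, Nat.cast_add, two_eq]
    exact (pt_precedes hx le_rfl).add (pt_precedes hx' le_rfl)

theorem zero_pt_add_zero_pt (y y' : ℕ) :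
    coordEquiv p (pt 0 y) + coordEquiv p (pt 0 y') = coordEquiv p (pt 0 (max y y')) :=
  eq_coordEquiv_zero fun j => by
    simp only [add_entry, BoolSemiring.add_eq_zero, coordEquiv_pt_entry]
    omega

theorem iterate_frob_pt (x y : ℕ) :
    frob^[y] (coordEquiv p (pt 0 y)) = 0 ∧
      frob^[y] (coordEquiv p (pt x 0)) = coordEquiv p (pt x 0) := by
  constructor
  · rw [zero_eq]
    refine eq_coordEquiv fun i j => ?_
    rw [iterate_frob_entry, coordEquiv_pt_entry, pt_le_pt]
    omega
  · refine eq_coordEquiv fun i j => ?_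
    rw [iterate_frob_entry, coordEquiv_pt_entry, pt_le_pt]
    omega

/-- The `y`-fold Frobenius map kills `(0, y)` and fixes `(x, 0)`, so for `j ≥ y` the sum has the
zeros of `(x, 0)`. Conversely the sum dominates both summands, so a zero of the sum is a zero of
each. -/
theorem pt_add_zero_pt (x y : ℕ) :
    coordEquiv p (pt x 0) + coordEquiv p (pt 0 y) = coordEquiv p (pt x y) := by
  refine Precedes.antisymm (precedes_iff.2 fun i j hij => ?_) (precedes_iff.2 fun i j hij => ?_)
  · obtain ⟨hi, hj⟩ := coordEquiv_pt_entry.1 hij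
    obtain ⟨l, rfl⟩ := Nat.exists_eq_add_of_le' hj
    rw [← iterate_frob_entry, iterate_frob_add, (iterate_frob_pt x y).1, (iterate_frob_pt x y).2,
      add_zero, coordEquiv_pt_entry]
    exact ⟨hi, zero_le⟩
  · have h1 := coordEquiv_pt_entry.1 (precedes_iff.1 (precedes_add_right _ _) i j hij)
    have h2 := coordEquiv_pt_entry.1 (precedes_iff.1 (precedes_add_left _ _) i j hij)
    exact coordEquiv_pt_entry.2 ⟨h1.1, h2.2⟩

/-! ### Products -/

theorem zero_pt_mul_zero_pt (y y' : ℕ) :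
    coordEquiv p (pt 0 y) * coordEquiv p (pt 0 y') = coordEquiv p (pt 0 (min y y')) :=
  eq_coordEquiv_zero fun j => by
    simp only [mul_entry, mul_eq_zero, coordEquiv_pt_entry, min_le_iff]
    omega

theorem pt_mul_zero_pt {x : ℕ} (hx : 1 ≤ x) (y : ℕ) :
    coordEquiv p (pt x 0) * coordEquiv p (pt 0 y) = coordEquiv p (pt 0 y) :=
  eq_coordEquiv_zero fun j => by
    simp only [mul_entry, mul_eq_zero, coordEquiv_pt_entry]
    omega

theorem top_mul_zero_pt (y : ℕ) :
    coordEquiv p ⊤ * coordEquiv p (pt 0 y) = coordEquiv p (pt 0 y) :=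
  eq_coordEquiv_zero fun j => by
    rw [mul_entry, coordEquiv_top_entry, one_mul, coordEquiv_pt_entry]
    omega

theorem top_mul_eq_top {a : PTypWitt p BoolSemiring}
    (ha : (1 : PTypWitt p BoolSemiring).Precedes a) : coordEquiv p ⊤ * a = coordEquiv p ⊤ := by
  refine eq_top_of_precedes ?_
  simpa only [mul_one] using (Precedes.refl (coordEquiv p ⊤)).mul ha

theorem top_mul_pt {x : ℕ} (hx : 1 ≤ x) :
    coordEquiv p ⊤ * coordEquiv p (pt x 0) = coordEquiv p ⊤ :=
  top_mul_eq_top (by rw [one_eq]; exact pt_precedes hx le_rfl)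

/-- The binomial terms of index `1` and `p - 1` have coefficient `p`, and they are different terms
because `p > 2`; the remaining middle terms are divisible by `p` and form `r`. -/
theorem exists_add_pow_eq {R : Type*} [CommSemiring R] (h : 2 < p) (v w : R) :
    ∃ r, (v + w) ^ p = v ^ p + w ^ p + p * (v * w ^ (p - 1) + v ^ (p - 1) * w + r) := by
  have hdvd : ∀ k, k ≠ 0 → k < p → p ∣ p.choose k := fun k h0 hk => hp.out.dvd_choose_self h0 hk
  obtain ⟨n, rfl⟩ : ∃ n, p = n + 3 := ⟨p - 3, by omega⟩
  have hsum : ∃ r : R, ∑ k ∈ Finset.range n,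
      v ^ (k + 1 + 1) * w ^ (n + 3 - (k + 1 + 1)) * ((n + 3).choose (k + 1 + 1) : R) =
      ((n + 3 : ℕ) : R) * r := by
    refine Finset.dvd_sum fun k hk => ?_
    have hk' := Finset.mem_range.1 hk
    exact (Nat.cast_dvd_cast (hdvd (k + 1 + 1) (by omega) (by omega))).mul_left _
  obtain ⟨r, hr⟩ := hsum
  refine ⟨r, ?_⟩
  rw [add_pow, Finset.sum_range_succ, Finset.sum_range_succ, Finset.sum_range_succ',
    Finset.sum_range_succ', hr]
  have e1 : (n + 3).choose (n + 2) = n + 3 := by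
    rw [Nat.choose_symm_of_eq_add (show n + 3 = n + 2 + 1 by ring), Nat.choose_one_right]
  have e2 : n + 3 - (n + 2) = 1 := by omega
  rw [show n + 3 - 1 = n + 2 from rfl, e1, e2, Nat.sub_self, Nat.sub_zero, Nat.choose_self, Nat.choose_zero_right,
    Nat.zero_add, Nat.choose_one_right]
  push_cast
  ring

theorem comul_dGen_rel (i j : ℕ) :
    p * comul p (dGen p (i + 1) j) + comul p (dGen p i (j + 1)) = comul p (dGen p i j) ^ p := by
  have := congrArg (comul p) (dGen_rel p i j)
  rwa [_root_.map_add, _root_.map_mul, map_pow, map_natCast] at this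

/-- Expand `d_{0,j} ^ p ⊗ d_{0,j} ^ p` by the relation `d_{0,j} ^ p = p d_{1,j} + d_{0,j+1}`, cancel
`d_{0,j+1} ⊗ d_{0,j+1}` and divide by `p`. The bracketing displays the two parts that start the
induction below. -/
theorem comul_dGen_one (j : ℕ) : comul p (dGen p 1 j) =
    (p * dGen p 1 j ⊗ₜ[ℕ] dGen p 1 j + dGen p 1 j ⊗ₜ[ℕ] dGen p 0 (j + 1)) +
      dGen p 0 (j + 1) ⊗ₜ[ℕ] dGen p 1 j := by
  refine pCancel_tensor (p := p) _ _ (comul p (dGen p 0 (j + 1))) ?_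
  have hsmul : (p : PTypSymFun p) * dGen p 1 j = p • dGen p 1 j := (nsmul_eq_mul _ _).symm
  rw [comul_dGen_rel, comul_dGen_zero, comul_dGen_zero, Algebra.TensorProduct.tmul_pow,
    ← dGen_rel, Nat.zero_add, hsmul]
  simp only [TensorProduct.add_tmul, TensorProduct.tmul_add, TensorProduct.tmul_smul,
    ← TensorProduct.smul_tmul']
  simp only [nsmul_eq_mul]
  ring

/-- Each `d_{i,j}` with `i ≥ 1` has a coproduct with two separate parts that are nonzero at `(a, b)`,
if `a_{i,j}` and `b_{i,j}` are nonzero for `i ≤ 1`. -/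
theorem exists_comul_dGen_eq_add (h : 2 < p) {a b : PTypWitt p BoolSemiring}
    (ha : ∀ j, a.entry 0 j = 1 ∧ a.entry 1 j = 1) (hb : ∀ j, b.entry 0 j = 1 ∧ b.entry 1 j = 1)
    (i j : ℕ) : ∃ v w, comul p (dGen p (i + 1) j) = v + w ∧
      pair a.hom b.hom v = 1 ∧ pair a.hom b.hom w = 1 := by
  induction i generalizing j with
  | zero =>
    refine ⟨_, _, comul_dGen_one j, ?_, ?_⟩
    · rw [_root_.map_add, add_comm, pair_tmul]
      change a.entry 1 j * b.entry 0 (j + 1) + _ = 1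
      rw [(ha _).2, (hb _).1, mul_one, BoolSemiring.one_add]
    · rw [pair_tmul]
      change a.entry 0 (j + 1) * b.entry 1 j = 1
      rw [(ha _).1, (hb _).2, mul_one]
  | succ i ih =>
    obtain ⟨v, w, hu, hv, hw⟩ := ih j
    obtain ⟨v', hv'⟩ := frob_tensor p v
    obtain ⟨w', hw'⟩ := frob_tensor p w
    obtain ⟨r, hr⟩ := exists_add_pow_eq h v w
    -- Since `v ^ p = p v' + (ψ ⊗ ψ) v`, and likewise for `w`, the terms `(ψ ⊗ ψ)(v + w)` of `(v +
    -- w) ^ p` are the coproduct of `d_{i+1,j+1}`. Cancelling them and dividing by `p` leaves one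
    -- mixed term for each new part, and each mixed term has value `1`.
    refine ⟨v * w ^ (p - 1) + v', v ^ (p - 1) * w + (w' + r), ?_, ?_, ?_⟩
    · refine pCancel_tensor (p := p) _ _ (comul p (dGen p (i + 1) (j + 1))) ?_
      rw [comul_dGen_rel, ← adamsP_dGen, comul_adamsP, hu, hr, hv', hw', _root_.map_add]
      ring
    · rw [_root_.map_add, _root_.map_mul, map_pow, hv, hw, one_pow, mul_one,
        BoolSemiring.one_add]
    · rw [_root_.map_add, _root_.map_mul, map_pow, hv, hw, one_pow, mul_one,
        BoolSemiring.one_add]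

theorem pt_mul_pt_eq_top {x x' : ℕ} (hx : 2 ≤ x) (hx' : 2 ≤ x') :
    coordEquiv p (pt x 0) * coordEquiv p (pt x' 0) = coordEquiv p ⊤ := by
  by_cases h : 2 < p
  -- For `p > 2` comparison with natural numbers is of no use: `1` is too small, and `2 = ∞` lies
  -- above `(x, 0)`. The bound `x ≥ 2` says that the entries with `i ≤ 1` are nonzero, which is what
  -- the coproduct argument needs.
  · have hent : ∀ x, 2 ≤ x → ∀ j, (coordEquiv p (pt x 0)).entry 0 j = 1 ∧
        (coordEquiv p (pt x 0)).entry 1 j = 1 := fun x hx j => by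
      simp only [← BoolSemiring.ne_zero_iff, Ne, coordEquiv_pt_entry]
      omega
    refine eq_coordEquiv fun i j => iff_of_false (BoolSemiring.ne_zero_iff.2 ?_)
      (not_top_le_pt i j)
    cases i with
    | zero => rw [mul_entry, (hent x hx j).1, (hent x' hx' j).1, mul_one]
    | succ i =>
      obtain ⟨v, w, hu, hv, hw⟩ := exists_comul_dGen_eq_add h (hent x hx) (hent x' hx') i j
      change pair _ _ (comul p (dGen p (i + 1) j)) = 1
      rw [hu, _root_.map_add, hv, hw, BoolSemiring.one_add]
  · obtain rfl := eq_two_of_not_two_lt h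
    refine eq_top_of_precedes ?_
    have h4 : ((2 * 2 : ℕ) : PTypWitt 2 BoolSemiring) = coordEquiv 2 ⊤ :=
      natCast_eq_top_of_eq_two (by norm_num)
    rw [← h4, Nat.cast_mul, two_eq]
    exact (pt_precedes hx le_rfl).mul (pt_precedes hx' le_rfl)

/-! ### Independence of the prime -/

/-- A family of Boolean Witt vectors, one for each prime `p > 2`, with the same coordinates. -/
def SameCoord (a : ∀ (p : ℕ) [Fact p.Prime], PTypWitt p BoolSemiring) : Prop :=
  ∃ z, ∀ (p : ℕ) [Fact p.Prime], 2 < p → a p = coordEquiv p z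

/-- Split both summands as `(x,0) + (0,y)` and regroup: the sums within each axis have known
coordinates, the same for all `p > 2`, and then recombine. -/
theorem SameCoord.add {a b : ∀ (p : ℕ) [Fact p.Prime], PTypWitt p BoolSemiring}
    (ha : SameCoord a) (hb : SameCoord b) : SameCoord fun p _ => a p + b p := by
  have hx : ∀ x x', SameCoord fun p _ => coordEquiv p (pt x 0) + coordEquiv p (pt x' 0) := by
    intro x x'
    rcases Nat.eq_zero_or_pos x with rfl | hx
    · exact ⟨pt x' 0, fun p _ _ => by beta_reduce; rw [← zero_eq, zero_add]⟩
    rcases Nat.eq_zero_or_pos x' with rfl | hx'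
    · exact ⟨pt x 0, fun p _ _ => by beta_reduce; rw [← zero_eq, add_zero]⟩
    exact ⟨⊤, fun p _ h => pt_add_pt_of_two_lt h hx hx'⟩
  obtain ⟨z, hz⟩ := ha
  obtain ⟨w, hw⟩ := hb
  rcases eq_top_or_eq_pt z with rfl | ⟨x, y, rfl⟩
  · exact ⟨⊤, fun p _ h => by beta_reduce; rw [hz p h, top_add]⟩
  rcases eq_top_or_eq_pt w with rfl | ⟨x', y', rfl⟩
  · exact ⟨⊤, fun p _ h => by beta_reduce; rw [hw p h, add_comm, top_add]⟩
  obtain ⟨t, ht⟩ := hx x x'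
  beta_reduce at ht
  have hsum : ∀ (p : ℕ) [Fact p.Prime], 2 < p →
      a p + b p = coordEquiv p t + coordEquiv p (pt 0 (max y y')) := fun p _ h => by
    rw [hz p h, hw p h, ← pt_add_zero_pt x, ← pt_add_zero_pt x', add_add_add_comm, ht p h,
      zero_pt_add_zero_pt]
  rcases eq_top_or_eq_pt t with rfl | ⟨u, v, rfl⟩
  · exact ⟨⊤, fun p _ h => by beta_reduce; rw [hsum p h, top_add]⟩
  · exact ⟨pt u (max v (max y y')), fun p _ h => by
      beta_reduce
      rw [hsum p h, ← pt_add_zero_pt u v, add_assoc, zero_pt_add_zero_pt, pt_add_zero_pt]⟩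

/-- By distributivity a product of finite elements is a sum of four products of axis elements, to
which the additive closure applies; products with `∞` are treated separately. -/
theorem SameCoord.mul {a b : ∀ (p : ℕ) [Fact p.Prime], PTypWitt p BoolSemiring}
    (ha : SameCoord a) (hb : SameCoord b) : SameCoord fun p _ => a p * b p := by
  have hxx : ∀ x x', SameCoord fun p _ => coordEquiv p (pt x 0) * coordEquiv p (pt x' 0) := by
    intro x x'
    -- `(0,0)` and `(1,0)` are the zero and the unit; all remaining products are `∞`.
    match x, x' with
    | 0, x' => exact ⟨pt 0 0, fun p _ _ => by beta_reduce; rw [← zero_eq, zero_mul]⟩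
    | x, 0 => exact ⟨pt 0 0, fun p _ _ => by beta_reduce; rw [← zero_eq, mul_zero]⟩
    | 1, x' => exact ⟨pt x' 0, fun p _ _ => by beta_reduce; rw [← one_eq, one_mul]⟩
    | x, 1 => exact ⟨pt x 0, fun p _ _ => by beta_reduce; rw [← one_eq, mul_one]⟩
    | x + 2, x' + 2 => exact ⟨⊤, fun p _ h => pt_mul_pt_eq_top (by omega) (by omega)⟩
  have hxy : ∀ x y, SameCoord fun p _ => coordEquiv p (pt x 0) * coordEquiv p (pt 0 y) := by
    intro x y
    rcases Nat.eq_zero_or_pos x with rfl | hx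
    · exact ⟨pt 0 0, fun p _ _ => by beta_reduce; rw [← zero_eq, zero_mul]⟩
    · exact ⟨pt 0 y, fun p _ _ => pt_mul_zero_pt hx y⟩
  have htop : ∀ w, SameCoord fun p _ => coordEquiv p ⊤ * coordEquiv p w := by
    intro w
    -- Either `w` dominates the unit and `∞ w = ∞`, or `w` lies on the axis `(0, y')`.
    by_cases hw : pt 1 0 ≤ w
    · refine ⟨⊤, fun p _ _ => top_mul_eq_top ?_⟩
      rwa [one_eq, coordEquiv_precedes]
    · rcases eq_top_or_eq_pt w with rfl | ⟨x', y', rfl⟩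
      · exact absurd le_top hw
      · obtain rfl : x' = 0 := by rw [pt_le_pt] at hw; omega
        exact ⟨pt 0 y', fun p _ _ => top_mul_zero_pt y'⟩
  obtain ⟨z, hz⟩ := ha
  obtain ⟨w, hw⟩ := hb
  rcases eq_top_or_eq_pt z with rfl | ⟨x, y, rfl⟩
  · obtain ⟨t, ht⟩ := htop w
    beta_reduce at ht
    exact ⟨t, fun p _ h => by beta_reduce; rw [hz p h, hw p h, ht p h]⟩
  rcases eq_top_or_eq_pt w with rfl | ⟨x', y', rfl⟩
  · obtain ⟨t, ht⟩ := htop (pt x y)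
    beta_reduce at ht
    exact ⟨t, fun p _ h => by beta_reduce; rw [hz p h, hw p h, mul_comm, ht p h]⟩
  have hyy : SameCoord fun p _ => coordEquiv p (pt 0 y) * coordEquiv p (pt 0 y') :=
    ⟨_, fun p _ _ => zero_pt_mul_zero_pt y y'⟩
  obtain ⟨t, ht⟩ := ((hxx x x').add (hxy x y')).add ((hxy x' y).add hyy)
  refine ⟨t, fun p _ h => ?_⟩
  beta_reduce at ht ⊢
  rw [hz p h, hw p h, ← ht p h, ← pt_add_zero_pt x, ← pt_add_zero_pt x']
  ring

/-- The bijection preserving the coordinates, for two primes greater than `2`. -/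
theorem exists_ringEquiv (p q : ℕ) [Fact p.Prime] [Fact q.Prime] (hp : 2 < p) (hq : 2 < q) :
    ∃ Ψ : PTypWitt p BoolSemiring ≃+* PTypWitt q BoolSemiring,
      ∀ z, Ψ (coordEquiv p z) = coordEquiv q z := by
  have hcoord : ∀ z, SameCoord fun p _ => coordEquiv p z := fun z => ⟨z, fun _ _ _ => rfl⟩
  let e := (coordEquiv p).symm.trans (coordEquiv q)
  have he : ∀ z, e (coordEquiv p z) = coordEquiv q z := fun z => by simp [e]
  refine ⟨{ e with map_mul' := fun a b => ?_, map_add' := fun a b => ?_ }, he⟩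
  · obtain ⟨z, rfl⟩ := (coordEquiv p).surjective a
    obtain ⟨w, rfl⟩ := (coordEquiv p).surjective b
    -- The coordinates `t` of the product are chosen before the prime, so the same `t` serves for
    -- `p` and for `q`.
    obtain ⟨t, ht⟩ := (hcoord z).mul (hcoord w)
    beta_reduce at ht
    change e _ = e _ * e _
    rw [ht p hp, he, he, he, ht q hq]
  · obtain ⟨z, rfl⟩ := (coordEquiv p).surjective a
    obtain ⟨w, rfl⟩ := (coordEquiv p).surjective b
    obtain ⟨t, ht⟩ := (hcoord z).add (hcoord w)
    beta_reduce at ht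
    change e _ = e _ + e _
    rw [ht p hp, he, he, he, ht q hq]

end PTypWitt

end

end BooleanWitt

theorem mainTheorem3 :
    ∃ φ : ∀ (p : ℕ) [Fact p.Prime],
        WithTop (ℕ × ℕ) ≃ BooleanWitt.PTypWitt p BooleanWitt.BoolSemiring,
      (∀ (p : ℕ) [Fact p.Prime],
        -- the bijection in coordinates
        (∀ x y i j : ℕ, (φ p (BooleanWitt.pt x y)).entry i j = 0 ↔ x ≤ i ∧ y ≤ j) ∧
        (∀ i j : ℕ, (φ p ⊤).entry i j = 1) ∧
        -- it is an isomorphism of partially ordered sets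
        (∀ z w : WithTop (ℕ × ℕ), (φ p z).Precedes (φ p w) ↔ z ≤ w) ∧
        -- the image of a natural number
        (∀ n : ℕ, (n ≤ 1 ∨ (p = 2 ∧ n ≤ 2)) →
          (n : BooleanWitt.PTypWitt p BooleanWitt.BoolSemiring) = φ p (BooleanWitt.pt n 0)) ∧
        (∀ n : ℕ, ¬(n ≤ 1 ∨ (p = 2 ∧ n ≤ 2)) →
          (n : BooleanWitt.PTypWitt p BooleanWitt.BoolSemiring) = φ p ⊤) ∧
        -- sums
        (∀ x x' : ℕ, 2 ≤ x → 2 ≤ x' →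
          φ p (BooleanWitt.pt x 0) + φ p (BooleanWitt.pt x' 0) = φ p ⊤) ∧
        (∀ y y' : ℕ, φ p (BooleanWitt.pt 0 y) + φ p (BooleanWitt.pt 0 y') =
          φ p (BooleanWitt.pt 0 (max y y'))) ∧
        (∀ x y : ℕ, φ p (BooleanWitt.pt x 0) + φ p (BooleanWitt.pt 0 y) =
          φ p (BooleanWitt.pt x y)) ∧
        (∀ z : WithTop (ℕ × ℕ), φ p ⊤ + φ p z = φ p ⊤) ∧
        -- products
        (∀ x x' : ℕ, 2 ≤ x → 2 ≤ x' →
          φ p (BooleanWitt.pt x 0) * φ p (BooleanWitt.pt x' 0) = φ p ⊤) ∧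
        (∀ y y' : ℕ, φ p (BooleanWitt.pt 0 y) * φ p (BooleanWitt.pt 0 y') =
          φ p (BooleanWitt.pt 0 (min y y'))) ∧
        (∀ x y : ℕ, 1 ≤ x → φ p (BooleanWitt.pt x 0) * φ p (BooleanWitt.pt 0 y) =
          φ p (BooleanWitt.pt 0 y)) ∧
        (∀ y : ℕ, φ p ⊤ * φ p (BooleanWitt.pt 0 y) = φ p (BooleanWitt.pt 0 y)) ∧
        (∀ x : ℕ, 1 ≤ x → φ p ⊤ * φ p (BooleanWitt.pt x 0) = φ p ⊤)) ∧
      -- in these coordinates the semiring structure does not depend on the prime `p > 2`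
      (∀ (p q : ℕ) [Fact p.Prime] [Fact q.Prime], 2 < p → 2 < q →
        ∃ Ψ : BooleanWitt.PTypWitt p BooleanWitt.BoolSemiring ≃+*
            BooleanWitt.PTypWitt q BooleanWitt.BoolSemiring,
          ∀ z : WithTop (ℕ × ℕ), Ψ (φ p z) = φ q z) := by
  refine ⟨fun p _ => BooleanWitt.PTypWitt.coordEquiv p, fun p _ => ?_,
    fun p q _ _ hp hq => BooleanWitt.PTypWitt.exists_ringEquiv p q hp hq⟩
  open BooleanWitt.PTypWitt in
  exact ⟨fun _ _ _ _ => coordEquiv_pt_entry, coordEquiv_top_entry,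
    fun _ _ => coordEquiv_precedes, fun _ => natCast_eq_pt, fun _ => natCast_eq_top,
    fun _ _ => pt_add_pt_eq_top, zero_pt_add_zero_pt, pt_add_zero_pt, fun _ => top_add _,
    fun _ _ => pt_mul_pt_eq_top, zero_pt_mul_zero_pt, fun _ y hx => pt_mul_zero_pt hx y,
    top_mul_zero_pt, fun _ => top_mul_pt⟩
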